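/- Fix $N\in\mathbb N$. A differential ring is a commutative ring containing $\mathbb Q$, equipped with $N$ commuting derivations $\partial_1,\dots,\partial_N$; differential subrings are subrings containing $\mathbb Q$ that are stable under all $\partial_i$, and homomorphisms of differential rings are ring homomorphisms commuting with all $\partial_i$. A differential field is a differential ring that is a field. A differential algebra over a differential field $K$ is a nonzero differential ring $S$ with a homomorphism of differential rings $K\to S$ (necessarily injective); homomorphisms of differential $K$-algebras are the homomorphisms of differential rings that are $K$-linear. $S$ is finitely generated over a subring $R$ (resp. over $K$) if some finite subset of $S$ is such that $S$ is the only differential subring of $S$ containing it together with $R$ (resp. the image of $K$). Finally, $K$ is differentially closed if for every $m$ and all finite sets $P,Q$ of differential polynomials over $K$ in $x_1,\dots,x_m$ the following holds: if there are a differential field extension $L$ of $K$ and a tuple $a\in L^m$ with $p(a)=0$ for all $p\in P$ and $q(a)\neq0$ for all $q\in Q$, then there is such a tuple in $K^m$. **Theorem.** Let $K$ be a differential field. The following are equivalent. 1. $K$ is differentially closed. 2. For every differential ring $S$ that is an integral domain, every differential subring $R\subseteq S$ over which $S$ is finitely generated, and every nonzero $b\in S$, there is a nonzero $a\in R$ such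 that every homomorphism of differential rings $\phi:R\to K$ with $\phi(a)\neq0$ extends to a homomorphism of differential rings $\psi:S\to K$ with $\psi(b)\neq 0$. 3. For every finitely generated differential $K$-algebra $S$ that is an integral domain and every nonzero $b\in S$, there is a homomorphism of differential $K$-algebras $\psi:S\to K$ with $\psi(b)\neq0$. 4. For every finitely generated differential $K$-algebra $S$ that is an integral domain there is a homomorphism of differential $K$-algebras $\psi:S\to K$. 5. For every finitely generated differential $K$-algebra $S$ there is a homomorphism of differential $K$-algebras $\psi:S\to K$. -/

import Mathlib

universe u v

/-- A commutative ring with `N` commuting derivations `∂₁, …, ∂_N` (a `Δ`-ring). That the ring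
contains `ℚ` is recorded separately, by `[Algebra ℚ R]` or `[CharZero K]`; it is automatic for
algebras over a field of characteristic zero. -/
class DeltaRing (N : ℕ) (R : Type*) [CommRing R] where
  /-- The derivations `∂ᵢ`. -/
  der : Fin N → Derivation ℤ R R
  der_comm : ∀ (i j : Fin N) (x : R), der i (der j x) = der j (der i x)

namespace DeltaRing

/-- The operator `∂₁^{e₁} ⋯ ∂_N^{e_N}`. -/
def theta {N : ℕ} {R : Type*} [CommRing R] [DeltaRing N R] (e : Fin N → ℕ) : Module.End ℤ R :=
  (List.ofFn fun i : Fin N => ((der i : Derivation ℤ R R) : Module.End ℤ R) ^ e i).prod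

end DeltaRing

/-- A ring homomorphism between `Δ`-rings that commutes with each of the derivations. -/
def IsDeltaHom (N : ℕ) {A B : Type*} [CommRing A] [CommRing B] [DeltaRing N A] [DeltaRing N B]
    (f : A →+* B) : Prop :=
  ∀ (i : Fin N) (x : A), f (DeltaRing.der i x) = DeltaRing.der i (f x)

/-- `B` is a differential `A`-algebra: the structure map `A → B` is a homomorphism of `Δ`-rings. -/
class IsDeltaAlgebra (N : ℕ) (A B : Type*) [CommRing A] [CommRing B] [DeltaRing N A]
    [DeltaRing N B] [Algebra A B] : Prop where
  isDeltaHom_algebraMap : IsDeltaHom N (algebraMap A B)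

/-- A subalgebra stable under all the derivations. -/
structure DeltaSubalgebra (N : ℕ) (A S : Type*) [CommRing A] [CommRing S] [Algebra A S]
    [DeltaRing N S] extends Subalgebra A S where
  der_mem : ∀ (i : Fin N) (x : S), x ∈ toSubalgebra → DeltaRing.der i x ∈ toSubalgebra

/-- The `Δ`-ring structure induced on a differential subalgebra, by restricting the derivations. -/
instance DeltaSubalgebra.instDeltaRing {N : ℕ} {A S : Type*} [CommRing A] [CommRing S]
    [Algebra A S] [DeltaRing N S] (R : DeltaSubalgebra N A S) : DeltaRing N R.toSubalgebra where
  der i := Derivation.mk'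
    { toFun := fun x => ⟨DeltaRing.der i (x : S), R.der_mem i x x.2⟩
      map_add' := fun x y => Subtype.ext (by simp)
      map_smul' := fun n x => Subtype.ext (by simp) }
    (fun x y => Subtype.ext (by simp))
  der_comm i j x := Subtype.ext (DeltaRing.der_comm i j (x : S))

/-- `S` is finitely generated over `A` as a differential algebra: there is a finite set `F` such
that the only differential `A`-subalgebra of `S` containing `F` is `S` itself. -/
def DeltaFiniteType (N : ℕ) (A S : Type*) [CommRing A] [CommRing S] [Algebra A S]
    [DeltaRing N S] : Prop :=
  ∃ F : Finset S, ∀ T : DeltaSubalgebra N A S, (∀ x ∈ F, x ∈ T.toSubalgebra) →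
    T.toSubalgebra = ⊤

/-- Differential polynomials in `x₁, …, x_m`: polynomials in the differential variables `θ x_j`,
the variable `∂₁^{e₁} ⋯ ∂_N^{e_N} x_j` being indexed by `(j, e)`. -/
abbrev DeltaPolynomial (N m : ℕ) (R : Type*) [CommRing R] : Type _ :=
  MvPolynomial (Fin m × (Fin N → ℕ)) R

/-- The value of a differential polynomial at a tuple `a`: each `θ x_j` is replaced by
`θ a_j`. -/
noncomputable def DeltaPolynomial.evalAt {N m : ℕ} {R B : Type*} [CommRing R] [CommRing B]
    [Algebra R B] [DeltaRing N B] (a : Fin m → B) (p : DeltaPolynomial N m R) : B :=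
  MvPolynomial.aeval (fun v : Fin m × (Fin N → ℕ) => DeltaRing.theta v.2 (a v.1)) p

/-- A differential field `K` is differentially closed if every finite system of differential
polynomial equations and inequations over `K` that has a solution in some differential field
extension `L` of `K` has one in `K`. (Only the subextension generated by the solution matters,
so it is enough to let `L` range over the universe of `K`.) -/
def IsDifferentiallyClosed (N : ℕ) (K : Type u) [Field K] [DeltaRing N K] : Prop :=
  ∀ (m : ℕ) (P Q : Finset (DeltaPolynomial N m K)),
    (∃ (L : Type u) (_ : Field L) (_ : DeltaRing N L) (_ : Algebra K L)
      (_ : IsDeltaAlgebra N K L) (a : Fin m → L),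
      (∀ p ∈ P, p.evalAt a = 0) ∧ ∀ q ∈ Q, q.evalAt a ≠ 0) →
    ∃ a : Fin m → K, (∀ p ∈ P, p.evalAt a = 0) ∧ ∀ q ∈ Q, q.evalAt a ≠ 0

/-! The substance is the step from 1 to 2. Let `S` be generated over `R` by a tuple `y`, and let `P`
be the kernel of evaluation at `y` on the differential polynomials over `R`: a prime differential
ideal meeting `R` in 0. Rank the differential variables, and call one a leader if it is algebraic
modulo `P` over the lower ones. By Dickson's lemma only finitely many leaders are minimal, that is,
not proper derivatives of other leaders. For each minimal leader take a relation of least degree.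
Its proper derivatives are linear in their own leaders, with the separant as coefficient. In
characteristic 0, minimality of the degree keeps initial and separant out of `P`.

Two consequences follow. First (`IsRanked.exists_finset_le`), `P` lies in every prime differential
ideal that contains these finitely many relations but not the product `H` of their initials and
separants. Second (`IsRanked.exists_specialization`), the non-leaders are algebraically independent
modulo `P`, and the residue ring lies in the algebra they generate together with finitely many
algebraic elements. So a homomorphism `φ` on `R` with `φ a ≠ 0` extends to a mere ring homomorphism
into an algebraic closure of `K` that kills `P` but not a given `b ∉ P`.

The second fact shows that the differential ideal generated by `φ(P)` over `K` contains no power of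
the image of `b`, so a prime differential ideal `Q` contains it and avoids that image
(`Ideal.IsStable.exists_le_prime`). By the first fact, applied to `Q` over `K`, a zero of `Q` is
secured by a finite system. That system is solvable in the fraction field modulo `Q`, hence in `K`;
evaluation at the solution is the required differential homomorphism.

The rest is formal. From 2 to 3, `R` is the image of `K`. From 4 to 5, pass to the quotient by a
prime differential ideal. From 5 to 1, take a point of the algebra generated by a solution in `L`
and the inverses of the values required to be nonzero. -/

open MvPolynomial

/-! ### Leaders of a prime ideal and relations of minimal degree -/

section Leaders

variable {V : Type*} {R : Type*} [CommRing R] [LinearOrder V]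

/-- Polynomials in the variables strictly below `v`. -/
noncomputable abbrev below (R : Type*) [CommRing R] (v : V) : Subalgebra R (MvPolynomial V R) :=
  supported R (Set.Iio v)

theorem exists_polynomial_below_of_mem_supported_Iic {w : V} {p : MvPolynomial V R}
    (hp : p ∈ supported R (Set.Iic w)) :
    ∃ f : Polynomial (below R w), p = Polynomial.aeval (X w : MvPolynomial V R) f := by
  rw [supported_eq_adjoin_X] at hp
  induction hp using Algebra.adjoin_induction with
  | mem x hx =>
    obtain ⟨u, hu, rfl⟩ := hx
    rcases lt_or_eq_of_le (Set.mem_Iic.1 hu) with h | rfl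
    · refine ⟨Polynomial.C ⟨X u, ?_⟩, ?_⟩
      · change X u ∈ supported R _
        rw [supported_eq_adjoin_X]
        exact Algebra.subset_adjoin ⟨u, h, rfl⟩
      · rw [Polynomial.aeval_C]; rfl
    · exact ⟨Polynomial.X, by simp⟩
  | algebraMap r =>
    exact ⟨Polynomial.C (algebraMap R _ r), by rw [Polynomial.aeval_C]; rfl⟩
  | add x y _ _ hx hy =>
    obtain ⟨f, rfl⟩ := hx
    obtain ⟨g, rfl⟩ := hy
    exact ⟨f + g, by simp⟩
  | mul x y _ _ hx hy =>
    obtain ⟨f, rfl⟩ := hx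
    obtain ⟨g, rfl⟩ := hy
    exact ⟨f * g, by simp⟩

theorem aeval_polynomial_below_mem_supported {w : V} (f : Polynomial (below R w)) {T : Set V}
    (hT : Set.Iio w ⊆ T) (hw : w ∈ T) :
    Polynomial.aeval (X w : MvPolynomial V R) f ∈ supported R T := by
  rw [Polynomial.aeval_eq_sum_range]
  refine Subalgebra.sum_mem _ fun k _ => ?_
  rw [Algebra.smul_def]
  refine Subalgebra.mul_mem _ (supported_mono hT (f.coeff k).2) (Subalgebra.pow_mem _ ?_ _)
  rw [supported_eq_adjoin_X]
  exact Algebra.subset_adjoin ⟨w, hw, rfl⟩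

/-- To prove something of all polynomials, it is enough to treat the constants, and the
polynomials in one variable `w` whose coefficients involve only variables below `w`, where the
polynomials below `w` are already known to have the property. -/
theorem MvPolynomial.induction_on_leader [WellFoundedLT V] {motive : MvPolynomial V R → Prop}
    (const : ∀ r, motive (C r))
    (step : ∀ (w : V) (f : Polynomial (below R w)), (∀ q ∈ below R w, motive q) →
      motive (Polynomial.aeval (X w : MvPolynomial V R) f)) (p : MvPolynomial V R) :
    motive p := by
  have key : ∀ p : MvPolynomial V R,
      (∀ w, (∀ u ∈ p.vars, u ≤ w) → w ∈ p.vars → ∀ q ∈ below R w, motive q) → motive p := by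
    intro p h
    rcases p.vars.eq_empty_or_nonempty with h0 | hne
    · rw [vars_eq_empty_iff_eq_C] at h0
      rw [h0]; exact const _
    · have hmem := Finset.max'_mem _ hne
      have hle : ∀ u ∈ p.vars, u ≤ p.vars.max' hne := fun u hu => Finset.le_max' _ _ hu
      obtain ⟨f, hf⟩ := exists_polynomial_below_of_mem_supported_Iic
        (mem_supported.2 fun u hu => hle u hu : p ∈ supported R (Set.Iic (p.vars.max' hne)))
      rw [hf]
      exact step _ _ (h _ hle hmem)
  -- Every variable of a polynomial below `w` is itself below `w`, so `key` applies by well-founded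
  -- induction on `w`.
  have aux : ∀ w : V, ∀ q ∈ below R w, motive q := by
    intro w
    induction w using WellFoundedLT.induction with
    | ind w ih =>
      intro q hq
      exact key q fun u _ hu => ih u (mem_supported.1 hq hu)
  exact key p fun w _ _ => aux w

/-- `v` is a leader of the prime ideal `P` if `X v` is algebraic modulo `P` over the polynomials
in lower variables. -/
def IsLeader (P : Ideal (MvPolynomial V R)) (v : V) : Prop :=
  ∃ f : Polynomial (below R v), Polynomial.aeval (X v : MvPolynomial V R) f ∈ P ∧
    ∃ k, (f.coeff k : MvPolynomial V R) ∉ P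

/-- A relation of minimal degree for the leader `v`. -/
structure IsMinimalRelation (P : Ideal (MvPolynomial V R)) {v : V}
    (f : Polynomial (below R v)) : Prop where
  mem : Polynomial.aeval (X v : MvPolynomial V R) f ∈ P
  leadingCoeff_notMem : (f.leadingCoeff : MvPolynomial V R) ∉ P
  coeff_mem : ∀ g : Polynomial (below R v), g.natDegree < f.natDegree →
    Polynomial.aeval (X v : MvPolynomial V R) g ∈ P → ∀ k, (g.coeff k : MvPolynomial V R) ∈ P

/-- Among relations with some coefficient outside `P`, choose one of least degree. Were its leading
coefficient in `P`, erasing the leading term would leave such a relation of smaller degree. -/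
theorem IsLeader.exists_isMinimalRelation {P : Ideal (MvPolynomial V R)} {v : V}
    (h : IsLeader P v) : ∃ f : Polynomial (below R v), IsMinimalRelation P f := by
  obtain ⟨f, ⟨hf, hk⟩, hmin⟩ := WellFounded.has_min
    (measure (Polynomial.natDegree (R := below R v))).wf
    {f | Polynomial.aeval (X v : MvPolynomial V R) f ∈ P ∧
      ∃ k, (f.coeff k : MvPolynomial V R) ∉ P} h
  have hmin' : ∀ g : Polynomial (below R v), g.natDegree < f.natDegree →
      Polynomial.aeval (X v : MvPolynomial V R) g ∈ P →
        ∀ k, (g.coeff k : MvPolynomial V R) ∈ P := by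
    intro g hg hgP k
    by_contra hc
    exact hmin g ⟨hgP, k, hc⟩ hg
  refine ⟨f, hf, fun hlc => ?_, hmin'⟩
  obtain ⟨k, hk⟩ := hk
  have hk0 : f.natDegree ≠ 0 := by
    intro h0
    rcases Nat.eq_zero_or_pos k with rfl | hpos
    · rw [Polynomial.leadingCoeff, h0] at hlc
      exact hk hlc
    · rw [Polynomial.coeff_eq_zero_of_natDegree_lt (by omega)] at hk
      exact hk P.zero_mem
  have hdeg : f.eraseLead.natDegree < f.natDegree := by
    have := Polynomial.eraseLead_natDegree_le f
    omega
  have hmem : Polynomial.aeval (X v : MvPolynomial V R) f.eraseLead ∈ P := by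
    rw [← Polynomial.self_sub_C_mul_X_pow, Polynomial.aeval_sub, map_mul, Polynomial.aeval_C]
    exact P.sub_mem hf (P.mul_mem_right _ hlc)
  have := hmin' _ hdeg hmem k
  rw [Polynomial.eraseLead_coeff] at this
  split_ifs at this with h1
  · subst h1; exact hk hlc
  · exact hk this

/-- The derivative has smaller degree, so if it were a relation its top coefficient, the degree
times the initial, would lie in `P`; the degree is invertible because `ℚ` acts on `R`. -/
theorem IsMinimalRelation.aeval_derivative_notMem [Algebra ℚ R] {P : Ideal (MvPolynomial V R)}
    [P.IsPrime] {v : V} {f : Polynomial (below R v)} (hf : IsMinimalRelation P f) :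
    Polynomial.aeval (X v : MvPolynomial V R) (Polynomial.derivative f) ∉ P := by
  intro hmem
  have hdeg : f.natDegree ≠ 0 := by
    intro h0
    apply hf.leadingCoeff_notMem
    have := hf.mem
    rw [Polynomial.eq_C_of_natDegree_eq_zero h0, Polynomial.aeval_C] at this
    rw [Polynomial.leadingCoeff, h0]
    exact this
  have := hf.coeff_mem _ (Polynomial.natDegree_derivative_lt hdeg) hmem (f.natDegree - 1)
  rw [Polynomial.coeff_derivative, Nat.sub_add_cancel (Nat.pos_of_ne_zero hdeg)] at this
  have hcast : ((f.natDegree - 1 : ℕ) : MvPolynomial V R) + 1 = algebraMap ℚ _ f.natDegree := by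
    rw [← Nat.cast_succ, Nat.succ_eq_add_one, Nat.sub_add_cancel (Nat.pos_of_ne_zero hdeg)]
    simp
  have hunit : IsUnit (algebraMap ℚ (MvPolynomial V R) f.natDegree) :=
    (IsUnit.mk0 (f.natDegree : ℚ) (by exact_mod_cast hdeg)).map _
  have h2 : (f.leadingCoeff : MvPolynomial V R) * algebraMap ℚ _ f.natDegree ∈ P := by
    rw [← hcast]
    simpa using this
  rcases Ideal.IsPrime.mem_or_mem ‹_› h2 with h3 | h3
  · exact hf.leadingCoeff_notMem h3
  · exact Ideal.IsPrime.ne_top ‹_› (Ideal.eq_top_of_isUnit_mem _ h3 hunit)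

/-- A minimal relation modulo `P` which also holds modulo the prime ideal `P'`, with initial not
in `P'`, transports relations from `P` to `P'`. -/
theorem IsMinimalRelation.aeval_mem {P P' : Ideal (MvPolynomial V R)} [P'.IsPrime] {v : V}
    {f : Polynomial (below R v)} (hf : IsMinimalRelation P f)
    (hmem : Polynomial.aeval (X v : MvPolynomial V R) f ∈ P')
    (hlc : (f.leadingCoeff : MvPolynomial V R) ∉ P')
    (ih : ∀ q ∈ below R v, q ∈ P → q ∈ P') (g : Polynomial (below R v))
    (hg : Polynomial.aeval (X v : MvPolynomial V R) g ∈ P) :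
    Polynomial.aeval (X v : MvPolynomial V R) g ∈ P' := by
  induction hn : g.natDegree using Nat.strong_induction_on generalizing g with
  | _ n IH =>
    subst hn
    by_cases hdeg : g.natDegree < f.natDegree
    · rw [Polynomial.aeval_eq_sum_range]
      refine P'.sum_mem fun k _ => ?_
      rw [Algebra.smul_def]
      exact P'.mul_mem_right _ (ih _ (g.coeff k).2 (hf.coeff_mem g hdeg hg k))
    · have hpos : 0 < g.natDegree := by
        by_contra h0
        have hf0 : f.natDegree = 0 := by omega
        apply hf.leadingCoeff_notMem
        have := hf.mem
        rw [Polynomial.eq_C_of_natDegree_eq_zero hf0, Polynomial.aeval_C] at this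
        rw [Polynomial.leadingCoeff, hf0]
        exact this
      -- One step of pseudo-division of `g` by `f`. It multiplies `g` by the initial of `f`, which
      -- is cancelled at the end because it is outside the prime `P'`.
      have hlt := Polynomial.natDegree_cancelLeads_lt_of_natDegree_le_natDegree
        (not_lt.1 hdeg) hpos
      have hexp : f.cancelLeads g = Polynomial.C f.leadingCoeff * g -
          Polynomial.C g.leadingCoeff * Polynomial.X ^ (g.natDegree - f.natDegree) * f := by
        rw [Polynomial.cancelLeads, Nat.sub_eq_zero_of_le (not_lt.1 hdeg), pow_zero, mul_one]
      have h1 : Polynomial.aeval (X v : MvPolynomial V R) (f.cancelLeads g) ∈ P := by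
        rw [hexp, Polynomial.aeval_sub, map_mul, map_mul]
        exact P.sub_mem (P.mul_mem_left _ hg) (P.mul_mem_left _ hf.mem)
      have h2 := IH _ hlt _ h1 rfl
      rw [hexp, Polynomial.aeval_sub, map_mul, map_mul,
        Submodule.sub_mem_iff_left _ (P'.mul_mem_left _ hmem), Polynomial.aeval_C] at h2
      exact (Ideal.IsPrime.mem_or_mem ‹_› h2).resolve_left hlc

end Leaders

/-! ### Reduction modulo minimal relations and their derivatives -/

section Reduction

variable {V ι : Type*} {R : Type*} [CommRing R] [LinearOrder V]

/-- Derivations of a commutative ring into itself. -/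
abbrev SelfDerivation (A : Type*) [CommRing A] : Type _ := Derivation ℤ A A

/-- An ideal stable under a family of derivations. -/
def Ideal.IsStable {A : Type*} [CommRing A] (d : ι → SelfDerivation A) (I : Ideal A) : Prop :=
  ∀ i, ∀ x ∈ I, d i x ∈ I

/-- A family of derivations of a polynomial ring which map variables to higher variables,
compatibly with their ordering, and constants to constants. -/
structure IsRanked (d : ι → SelfDerivation (MvPolynomial V R))
    (δ : ι → V → V) : Prop where
  der_X : ∀ i v, d i (X v) = X (δ i v)
  der_C : ∀ i r, ∃ r', d i (C r) = C r'
  strictMono : ∀ i, StrictMono (δ i)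
  lt : ∀ i v, v < δ i v
  wqo : WellQuasiOrdered (Relation.ReflTransGen fun v w => ∃ i, δ i v = w)

namespace IsRanked

variable {d : ι → SelfDerivation (MvPolynomial V R)} {δ : ι → V → V}

theorem X_mem_below {v w : V} (h : v < w) : (X v : MvPolynomial V R) ∈ below R w := by
  change X v ∈ supported R _
  rw [supported_eq_adjoin_X]
  exact Algebra.subset_adjoin ⟨v, h, rfl⟩

theorem der_mem_below (hd : IsRanked d δ) (i : ι) {v : V} {p : MvPolynomial V R}
    (hp : p ∈ below R v) : d i p ∈ below R (δ i v) := by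
  have hle : below R v ≤ below R (δ i v) :=
    supported_mono (Set.Iio_subset_Iio (hd.lt i v).le)
  change p ∈ supported R _ at hp
  rw [supported_eq_adjoin_X] at hp
  induction hp using Algebra.adjoin_induction with
  | mem x hx =>
    obtain ⟨u, hu, rfl⟩ := hx
    rw [hd.der_X]
    exact X_mem_below (hd.strictMono i hu)
  | algebraMap r =>
    obtain ⟨r', hr'⟩ := hd.der_C i r
    rw [MvPolynomial.algebraMap_eq, hr']
    exact Subalgebra.algebraMap_mem _ r'
  | add x y _ _ hx hy => rw [map_add]; exact Subalgebra.add_mem _ hx hy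
  | mul x y hx' hy' hx hy =>
    rw [Derivation.leibniz, smul_eq_mul, smul_eq_mul]
    exact Subalgebra.add_mem _ (Subalgebra.mul_mem _ (hle hx') hy)
      (Subalgebra.mul_mem _ (hle hy') hx)

/-- Chain rule: only differentiating `X v` itself produces `X (δ i v)`. Derivatives of the
coefficients stay below `δ i v` because `δ i` is strictly increasing. -/
theorem exists_der_aeval (hd : IsRanked d δ) (i : ι) {v : V} (f : Polynomial (below R v)) :
    ∃ r ∈ below R (δ i v), d i (Polynomial.aeval (X v : MvPolynomial V R) f) =
      Polynomial.aeval (X v : MvPolynomial V R) (Polynomial.derivative f) * X (δ i v) + r := by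
  induction f using Polynomial.induction_on' with
  | add f g hf hg =>
    obtain ⟨r, hr, hf⟩ := hf
    obtain ⟨s, hs, hg⟩ := hg
    refine ⟨r + s, Subalgebra.add_mem _ hr hs, ?_⟩
    rw [map_add, map_add, hf, hg, Polynomial.derivative_add, map_add]
    ring
  | monomial n c =>
    refine ⟨X v ^ n * d i c, Subalgebra.mul_mem _ (Subalgebra.pow_mem _ (X_mem_below (hd.lt i v)) _)
      (hd.der_mem_below i c.2), ?_⟩
    rw [Polynomial.derivative_monomial, Polynomial.aeval_monomial, Polynomial.aeval_monomial,
      Derivation.leibniz, Derivation.leibniz_pow, hd.der_X, map_mul, map_natCast]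
    simp only [smul_eq_mul, nsmul_eq_mul]
    change (c : MvPolynomial V R) * _ + _ = (c : MvPolynomial V R) * _ * _ * _ + _
    ring_nf
    rfl

/-- Proper derivatives of a polynomial with leader `v` are linear in their leader, with
coefficient the separant. -/
theorem exists_linear (hd : IsRanked d δ) {v w : V} (f : Polynomial (below R v))
    (h : Relation.TransGen (fun v w => ∃ i, δ i v = w) v w) :
    Polynomial.aeval (X v : MvPolynomial V R) (Polynomial.derivative f) ∈ below R w ∧
    ∃ r ∈ below R w, ∀ I : Ideal (MvPolynomial V R), I.IsStable d →
      Polynomial.aeval (X v : MvPolynomial V R) f ∈ I →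
      Polynomial.aeval (X v : MvPolynomial V R) (Polynomial.derivative f) * X w + r ∈ I := by
  -- The remainder `r` is fixed before the ideal `I`, so one linear polynomial serves several
  -- differential ideals at once.
  induction h with
  | single h =>
    obtain ⟨i, rfl⟩ := h
    obtain ⟨r, hr, hf⟩ := hd.exists_der_aeval i f
    exact ⟨aeval_polynomial_below_mem_supported _ (Set.Iio_subset_Iio (hd.lt i v).le) (hd.lt i v),
      r, hr, fun I hI hfI => hf ▸ hI i _ hfI⟩
  | @tail w w' _ h ih =>
    obtain ⟨i, rfl⟩ := h
    obtain ⟨hs, r, hr, hI⟩ := ih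
    have hle : below R w ≤ below R (δ i w) :=
      supported_mono (Set.Iio_subset_Iio (hd.lt i w).le)
    refine ⟨hle hs, X w * d i (Polynomial.aeval (X v : MvPolynomial V R)
      (Polynomial.derivative f)) + d i r,
      Subalgebra.add_mem _ (Subalgebra.mul_mem _ (X_mem_below (hd.lt i w))
        (hd.der_mem_below i hs)) (hd.der_mem_below i hr), fun I hst hfI => ?_⟩
    have := hst i _ (hI I hst hfI)
    rw [map_add, Derivation.leibniz, hd.der_X, smul_eq_mul, smul_eq_mul, add_assoc] at this
    exact this

/-- The leaders of `P` that are not proper derivatives of other leaders. -/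
def minimalLeaders (δ : ι → V → V) (P : Ideal (MvPolynomial V R)) : Set V :=
  {v | IsLeader P v ∧ ∀ u, IsLeader P u →
    Relation.ReflTransGen (fun v w => ∃ i, δ i v = w) u v → u = v}

theorem le_of_reflTransGen (hd : IsRanked d δ) {v w : V}
    (h : Relation.ReflTransGen (fun v w => ∃ i, δ i v = w) v w) : v ≤ w := by
  induction h with
  | refl => exact le_rfl
  | tail _ h ih =>
    obtain ⟨i, rfl⟩ := h
    exact ih.trans (hd.lt i _).le

/-- Minimal leaders form an antichain for the relation "is a derivative of", which is a
well-quasi-order. -/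
theorem finite_minimalLeaders (hd : IsRanked d δ) (P : Ideal (MvPolynomial V R)) :
    (minimalLeaders δ P).Finite := by
  refine IsAntichain.finite_of_wellQuasiOrdered ?_ hd.wqo
  intro a ha b hb hab h
  exact hab (hb.2 a ha.1 h)

theorem exists_minimalLeader [WellFoundedLT V] (hd : IsRanked d δ)
    {P : Ideal (MvPolynomial V R)} {v : V} (hv : IsLeader P v) :
    ∃ u ∈ minimalLeaders δ P, Relation.ReflTransGen (fun v w => ∃ i, δ i v = w) u v := by
  obtain ⟨u, ⟨hu, huv⟩, hmin⟩ := WellFounded.has_min (wellFounded_lt (α := V))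
    {u | IsLeader P u ∧ Relation.ReflTransGen (fun v w => ∃ i, δ i v = w) u v} ⟨v, hv, .refl⟩
  refine ⟨u, ⟨hu, fun u' hu' h => ?_⟩, huv⟩
  by_contra hne
  exact hmin u' ⟨hu', h.trans huv⟩ (lt_of_le_of_ne (hd.le_of_reflTransGen h) hne)

/-- A prime differential ideal `P` is determined, among the prime differential ideals not
containing a certain `H ∉ P`, by finitely many of its elements. -/
theorem exists_finset_le [Algebra ℚ R] [WellFoundedLT V] (hd : IsRanked d δ)
    (P : Ideal (MvPolynomial V R)) [P.IsPrime] (hP : P.IsStable d) (hC : ∀ r, C r ∈ P → r = 0) :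
    ∃ (A : Finset (MvPolynomial V R)) (H : MvPolynomial V R), (∀ p ∈ A, p ∈ P) ∧ H ∉ P ∧
      ∀ P' : Ideal (MvPolynomial V R), P'.IsPrime → P'.IsStable d → (∀ p ∈ A, p ∈ P') →
        H ∉ P' → P ≤ P' := by
  classical
  have hf : ∀ v : V, ∃ f : Polynomial (below R v), IsLeader P v → IsMinimalRelation P f := by
    intro v
    by_cases hv : IsLeader P v
    · obtain ⟨f, hf⟩ := hv.exists_isMinimalRelation
      exact ⟨f, fun _ => hf⟩
    · exact ⟨0, fun h => absurd h hv⟩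
  choose f hf using hf
  set M := (hd.finite_minimalLeaders P).toFinset
  have hML : ∀ v ∈ M, IsMinimalRelation P (f v) := fun v hv =>
    hf v ((Set.Finite.mem_toFinset _).1 hv).1
  let s : V → MvPolynomial V R := fun v =>
    Polynomial.aeval (X v : MvPolynomial V R) (Polynomial.derivative (f v))
  have hs : ∀ v ∈ M, s v ∉ P := fun v hv => (hML v hv).aeval_derivative_notMem
  refine ⟨M.image fun v => Polynomial.aeval (X v : MvPolynomial V R) (f v),
    ∏ v ∈ M, ((f v).leadingCoeff : MvPolynomial V R) * s v, ?_, ?_, ?_⟩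
  · intro p hp
    obtain ⟨v, hv, rfl⟩ := Finset.mem_image.1 hp
    exact (hML v hv).mem
  · rw [Ideal.IsPrime.prod_mem_iff]
    rintro ⟨v, hv, h⟩
    rcases Ideal.IsPrime.mem_or_mem ‹_› h with h | h
    · exact (hML v hv).leadingCoeff_notMem h
    · exact hs v hv h
  · intro P' hP' hst hA hH
    have hA' : ∀ v ∈ M, Polynomial.aeval (X v : MvPolynomial V R) (f v) ∈ P' := fun v hv =>
      hA _ (Finset.mem_image_of_mem _ hv)
    have hH' : ∀ v ∈ M, ((f v).leadingCoeff : MvPolynomial V R) ∉ P' ∧ s v ∉ P' := by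
      intro v hv
      rw [Ideal.IsPrime.prod_mem_iff] at hH
      push Not at hH
      exact ⟨fun h => hH v hv (P'.mul_mem_right _ h), fun h => hH v hv (P'.mul_mem_left _ h)⟩
    intro p
    induction p using MvPolynomial.induction_on_leader with
    | const r =>
      intro hr
      rw [hC r hr, map_zero]
      exact P'.zero_mem
    | step w g ih =>
      intro hg
      by_cases hw : IsLeader P w
      · obtain ⟨v, hv, hvw⟩ := hd.exists_minimalLeader hw
        have hvM : v ∈ M := (Set.Finite.mem_toFinset _).2 hv
        rcases Relation.reflTransGen_iff_eq_or_transGen.1 hvw with rfl | hvw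
        · exact (hML _ hvM).aeval_mem (hA' _ hvM) (hH' _ hvM).1 ih g hg
        · obtain ⟨hsw, r, hr, hI⟩ := hd.exists_linear (f v) hvw
          -- For a proper derivative `w` of a minimal leader, the differentiated relation has degree
          -- one with the separant as initial. It is therefore minimal for `w`, and reduction works
          -- as it does for `v`.
          set h : Polynomial (below R w) :=
            Polynomial.C ⟨s v, hsw⟩ * Polynomial.X + Polynomial.C ⟨r, hr⟩ with hh
          have hs0 : (⟨s v, hsw⟩ : below R w) ≠ 0 := by
            intro h0
            apply hs v hvM
            rw [show s v = 0 from congrArg Subtype.val h0]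
            exact P.zero_mem
          have hev : Polynomial.aeval (X w : MvPolynomial V R) h = s v * X w + r := by
            rw [hh, map_add, map_mul, Polynomial.aeval_C, Polynomial.aeval_C, Polynomial.aeval_X]
            rfl
          have hlc : (h.leadingCoeff : MvPolynomial V R) = s v := by
            rw [hh, Polynomial.leadingCoeff_linear hs0]
          have hmin : IsMinimalRelation P h := by
            refine ⟨hev ▸ hI P hP (hML v hvM).mem, hlc ▸ hs v hvM, fun q hq hqP k => ?_⟩
            rw [hh, Polynomial.natDegree_linear hs0, Nat.lt_one_iff] at hq
            rw [Polynomial.eq_C_of_natDegree_eq_zero hq] at hqP ⊢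
            rw [Polynomial.aeval_C] at hqP
            rw [Polynomial.coeff_C]
            split_ifs
            · exact hqP
            · exact P.zero_mem
          exact hmin.aeval_mem (hev ▸ hI P' hst (hA' v hvM)) (hlc ▸ (hH' v hvM).2) ih g hg
      -- If `w` is not a leader, all coefficients of `g` lie in `P`, and the induction hypothesis
      -- applies to each.
      · rw [IsLeader] at hw
        push Not at hw
        rw [Polynomial.aeval_eq_sum_range]
        refine P'.sum_mem fun k _ => ?_
        rw [Algebra.smul_def]
        exact P'.mul_mem_right _ (ih _ (g.coeff k).2 (hw g hg k))

end IsRanked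

end Reduction

/-! ### Extending homomorphisms to an algebraically closed field -/

section Extension

/-- Homomorphisms to an algebraically closed field extend along integral extensions. -/
theorem RingHom.exists_extension_of_isIntegral {A C k : Type*} [CommRing A] [CommRing C]
    [Algebra A C] [Algebra.IsIntegral A C] (hinj : Function.Injective (algebraMap A C))
    [Field k] [IsAlgClosed k] (φ : A →+* k) : ∃ ψ : C →+* k, ∀ a, ψ (algebraMap A C a) = φ a := by
  have hp : (RingHom.ker φ).IsPrime := RingHom.ker_isPrime φ
  -- Lying over: modulo `Q` and the kernel of `φ` the extension is an algebraic extension of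
  -- domains, so the embedding into `k` lifts.
  obtain ⟨Q, -, hQ, hQp⟩ := Ideal.exists_ideal_over_prime_of_isIntegral (RingHom.ker φ)
    (⊥ : Ideal C) (by
      rw [← RingHom.ker_eq_comap_bot, (RingHom.injective_iff_ker_eq_bot _).1 hinj]
      exact bot_le)
  have : Q.LiesOver (RingHom.ker φ) := ⟨hQp.symm⟩
  let _ : Algebra (A ⧸ RingHom.ker φ) k := (RingHom.kerLift φ).toAlgebra
  have : FaithfulSMul (A ⧸ RingHom.ker φ) k :=
    (faithfulSMul_iff_algebraMap_injective _ _).2 (RingHom.kerLift_injective φ)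
  have : Algebra.IsIntegral (A ⧸ RingHom.ker φ) (C ⧸ Q) := inferInstance
  have : Algebra.IsAlgebraic (A ⧸ RingHom.ker φ) (C ⧸ Q) := inferInstance
  have : Module.IsTorsionFree (A ⧸ RingHom.ker φ) (C ⧸ Q) :=
    Module.isTorsionFree_iff_faithfulSMul.2 inferInstance
  have : Module.IsTorsionFree (A ⧸ RingHom.ker φ) k :=
    Module.isTorsionFree_iff_faithfulSMul.2 inferInstance
  let ψ : (C ⧸ Q) →ₐ[A ⧸ RingHom.ker φ] k := IsAlgClosed.lift
  refine ⟨ψ.toRingHom.comp (Ideal.Quotient.mk Q), fun a => ?_⟩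
  have := ψ.commutes (Ideal.Quotient.mk _ a)
  exact this

/-- Let `L` be a field containing a domain `R`, and let `c` be finitely many elements of `L`
algebraic over `R[z]`, where `z` is a family of algebraically independent elements. Then every
homomorphism from `R` to an algebraically closed field which does not vanish on a certain nonzero
`a : R` extends to `R[z, c]`. -/
theorem AlgebraicIndependent.exists_extension {R L W : Type*} [CommRing R] [IsDomain R] [Field L]
    [Algebra R L] {z : W → L} (hz : AlgebraicIndependent R z) (c : Finset L)
    (hc : ∀ x ∈ c, IsAlgebraic (Algebra.adjoin R (Set.range z)) x) :
    ∃ a : R, a ≠ 0 ∧ ∀ {k : Type u} [Field k] [IsAlgClosed k] (φ : R →+* k), φ a ≠ 0 →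
      ∃ ψ : Algebra.adjoin R (Set.range z ∪ c) →+* k, ∀ r, ψ (algebraMap R _ r) = φ r := by
  classical
  let _ : Algebra (MvPolynomial W R) L := (aeval z).toAlgebra
  have hinj : Function.Injective (algebraMap (MvPolynomial W R) L) := hz
  have hT : IsScalarTower R (MvPolynomial W R) L := IsScalarTower.of_algebraMap_eq fun r => by
    change _ = aeval z (C r)
    simp
  have hc' : ∀ x : L, ∃ g : MvPolynomial W R, g ≠ 0 ∧
      (x ∈ c → IsIntegral (MvPolynomial W R) (algebraMap _ L g * x)) := by
    intro x
    by_cases hx : x ∈ c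
    · have : IsAlgebraic (MvPolynomial W R) x := by
        refine (hc x hx).of_ringHom_of_comp_eq hz.aevalEquiv (RingHom.id L)
          hz.aevalEquiv.surjective Function.injective_id (RingHom.ext fun p => ?_)
        exact (hz.algebraMap_aevalEquiv p).trans rfl
      obtain ⟨g, hg, h⟩ := this.exists_integral_multiple
      exact ⟨g, hg, fun _ => Algebra.smul_def g x ▸ h⟩
    · exact ⟨1, one_ne_zero, fun h => absurd h hx⟩
  choose g hg0 hg using hc'
  set G := ∏ x ∈ c, g x
  have hG0 : G ≠ 0 := Finset.prod_ne_zero_iff.2 fun x _ => hg0 x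
  obtain ⟨e, he⟩ := MvPolynomial.ne_zero_iff.1 hG0
  -- `G` is a common denominator making every element of `c` integral. One nonzero coefficient
  -- surviving under `φ` keeps the image of `G` nonzero, and over the infinite field `k` that image
  -- is nonzero at some point `ζ`, where the `z` are sent.
  refine ⟨G.coeff e, he, fun {k} _ _ φ hφ => ?_⟩
  have hmap : MvPolynomial.map φ G ≠ 0 := by
    rw [MvPolynomial.ne_zero_iff]
    exact ⟨e, by rwa [MvPolynomial.coeff_map]⟩
  obtain ⟨ζ, hζ⟩ : ∃ ζ : W → k, MvPolynomial.eval ζ (MvPolynomial.map φ G) ≠ 0 := by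
    by_contra! h
    exact hmap (MvPolynomial.funext fun ζ => by rw [h, map_zero])
  rw [MvPolynomial.eval_map] at hζ
  let B := Localization.Away G
  let χ : B →+* k := IsLocalization.Away.lift (S := B) G (g := MvPolynomial.eval₂Hom φ ζ)
    (isUnit_iff_ne_zero.2 hζ)
  let _ : Algebra B L := (IsLocalization.Away.lift (S := B) G (g := algebraMap _ L)
    (isUnit_iff_ne_zero.2 ((map_ne_zero_iff _ hinj).2 hG0))).toAlgebra
  have hTB : IsScalarTower (MvPolynomial W R) B L := IsScalarTower.of_algebraMap_eq fun r =>
    (IsLocalization.Away.lift_eq (S := B) G _ r).symm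
  have hBinj : Function.Injective (algebraMap B L) := by
    refine (injective_iff_map_eq_zero _).2 fun x hx => ?_
    obtain ⟨⟨p, s⟩, hps⟩ := IsLocalization.surj (Submonoid.powers G) x
    have h0 : algebraMap (MvPolynomial W R) L p = 0 := by
      rw [IsScalarTower.algebraMap_apply (MvPolynomial W R) B L, ← hps, map_mul, hx, zero_mul]
    rw [(map_eq_zero_iff _ hinj).1 h0, map_zero] at hps
    exact (IsUnit.mul_left_eq_zero (IsLocalization.map_units B s)).1 hps
  obtain ⟨ψ, hψ⟩ := RingHom.exists_extension_of_isIntegral (A := B) (C := integralClosure B L)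
    (fun x y h => hBinj (congrArg Subtype.val h)) χ
  -- Each `g x` divides `G`, hence is a unit in `B`, so `x` itself is integral over `B`.
  have hle : Algebra.adjoin R (Set.range z ∪ c) ≤
      ((integralClosure B L).restrictScalars (MvPolynomial W R)).restrictScalars R := by
    refine Algebra.adjoin_le ?_
    rintro x (⟨w, rfl⟩ | hx)
    · have : z w = algebraMap B L (algebraMap (MvPolynomial W R) B (X w)) := by
        rw [← IsScalarTower.algebraMap_apply]
        exact (aeval_X z w).symm
      rw [this]
      exact Subalgebra.algebraMap_mem (integralClosure B L) _
    · have h1 : IsIntegral B (algebraMap _ L (g x) * x) := (hg x hx).tower_top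
      have h2 : IsUnit (algebraMap (MvPolynomial W R) B (g x)) :=
        isUnit_of_dvd_unit (map_dvd _ (Finset.dvd_prod_of_mem g hx))
          (IsLocalization.Away.algebraMap_isUnit (S := B) G)
      obtain ⟨u, hu⟩ := h2
      have h3 : x = algebraMap B L ↑u⁻¹ * (algebraMap _ L (g x) * x) := by
        rw [IsScalarTower.algebraMap_apply (MvPolynomial W R) B L, ← hu, ← mul_assoc, ← map_mul,
          Units.inv_mul, map_one, one_mul]
      change IsIntegral B x
      rw [h3]
      exact isIntegral_algebraMap.mul h1
  refine ⟨ψ.comp (Subalgebra.inclusion hle).toRingHom, fun r => ?_⟩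
  have h4 := hψ (algebraMap (MvPolynomial W R) B (C r))
  have h5 : χ (algebraMap (MvPolynomial W R) B (C r)) = φ r := by
    simp [χ]
  rw [← h5, ← h4]
  refine congrArg ψ (Subtype.ext ?_)
  change algebraMap R L r = algebraMap B L (algebraMap (MvPolynomial W R) B (C r))
  rw [← IsScalarTower.algebraMap_apply, IsScalarTower.algebraMap_apply R (MvPolynomial W R) L]
  rfl

end Extension

/-! ### Algebraic specializations of a prime differential ideal -/

section Specialization

variable {V ι : Type*} {R : Type*} [CommRing R] [LinearOrder V]
  {d : ι → SelfDerivation (MvPolynomial V R)} {δ : ι → V → V}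

/-- The classes modulo `P` of the variables that are not leaders are algebraically independent. -/
theorem algebraicIndependent_nonleaders [WellFoundedLT V] {P : Ideal (MvPolynomial V R)}
    (hC : ∀ r, C r ∈ P → r = 0) {L : Type*} [CommRing L] [Algebra R L]
    (ev : MvPolynomial V R →ₐ[R] L) (hev : ∀ p, ev p = 0 ↔ p ∈ P) :
    AlgebraicIndependent R fun v : {v // ¬ IsLeader P v} => ev (X v.1) := by
  rw [algebraicIndependent_iff]
  have hren : ∀ p : MvPolynomial {v // ¬ IsLeader P v} R,
      aeval (fun v : {v // ¬ IsLeader P v} => ev (X v.1)) p = ev (rename Subtype.val p) := by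
    intro p
    rw [← AlgHom.comp_apply]
    congr 1
    ext v
    simp
  intro p hp
  rw [hren, hev] at hp
  revert hp
  induction p using MvPolynomial.induction_on_leader with
  | const r =>
    intro hp
    rw [rename_C] at hp
    rw [hC r hp, map_zero]
  | step w f ih =>
    intro hp
    have hle : ∀ q ∈ below R w, rename Subtype.val q ∈ below R w.1 := by
      intro q hq
      classical
      refine mem_supported.2 fun u hu => ?_
      obtain ⟨u', hu', rfl⟩ := Finset.mem_image.1 (vars_rename _ _ hu)
      exact mem_supported.1 hq hu'
    let ρ : below R w →ₐ[R] below R w.1 :=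
      ((rename Subtype.val).comp (below R w).val).codRestrict _ fun q => hle q q.2
    have hmap (g : Polynomial (below R w)) :
        Polynomial.aeval (X w.1 : MvPolynomial V R) (g.map ρ.toRingHom) =
        rename Subtype.val (Polynomial.aeval (X w : MvPolynomial {v // ¬ IsLeader P v} R) g) := by
      induction g using Polynomial.induction_on' with
      | add f g hf hg => rw [Polynomial.map_add, map_add, map_add, map_add, hf, hg]
      | monomial n c =>
        rw [Polynomial.map_monomial, Polynomial.aeval_monomial, Polynomial.aeval_monomial, map_mul,
          map_pow, rename_X]
        rfl
    have hw := w.2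
    rw [IsLeader] at hw
    push Not at hw
    -- As `w` is not a leader, every coefficient of the relation is itself a relation, in lower
    -- non-leaders; by induction all of them vanish.
    have := hw _ (hmap f ▸ hp)
    have hf : f = 0 := by
      ext1 k
      refine Subtype.ext (ih _ (f.coeff k).2 ?_)
      have h1 := this k
      rw [Polynomial.coeff_map] at h1
      exact h1
    rw [hf, map_zero]

/-- The residue ring of `P` is algebraic over the classes of the variables that are not leaders. -/
theorem isAlgebraic_adjoin_nonleaders [WellFoundedLT V] [IsDomain R] {P : Ideal (MvPolynomial V R)}
    {L : Type*} [Field L] [Algebra R L] [FaithfulSMul R L]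
    (ev : MvPolynomial V R →ₐ[R] L) (hev : ∀ p, ev p = 0 ↔ p ∈ P) (p : MvPolynomial V R) :
    IsAlgebraic (Algebra.adjoin R (Set.range fun v : {v // ¬ IsLeader P v} => ev (X v.1)))
      (ev p) := by
  set B := Algebra.adjoin R (Set.range fun v : {v // ¬ IsLeader P v} => ev (X v.1))
  set T : Subalgebra R L := (Subalgebra.algebraicClosure B L).restrictScalars R
  have hX : ∀ v, ev (X v) ∈ T := by
    intro v
    induction v using WellFoundedLT.induction with
    | ind v ih =>
      by_cases hv : IsLeader P v
      · have hle : ∀ q ∈ below R v, ev q ∈ T := by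
          intro q hq
          change q ∈ supported R _ at hq
          rw [supported_eq_adjoin_X] at hq
          have : Algebra.adjoin R (X '' Set.Iio v) ≤ T.comap ev := by
            refine Algebra.adjoin_le ?_
            rintro _ ⟨u, hu, rfl⟩
            exact ih u hu
          exact this hq
        obtain ⟨f, hf, k, hk⟩ := hv
        let ρ : below R v →ₐ[R] Subalgebra.algebraicClosure B L :=
          { toFun := fun q => ⟨ev q, hle q q.2⟩
            map_one' := Subtype.ext (by simp)
            map_mul' := fun x y => Subtype.ext (by simp)
            map_zero' := Subtype.ext (by simp)
            map_add' := fun x y => Subtype.ext (by simp)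
            commutes' := fun r => Subtype.ext (by
              change ev (algebraMap R _ r) = algebraMap R L r
              exact ev.commutes r) }
        -- The relation stays nonzero after applying `ev` to its coefficients, since one of them is
        -- outside `P`. Transitivity of algebraicity then descends to `B`.
        have halg : IsAlgebraic (Subalgebra.algebraicClosure B L) (ev (X v)) := by
          refine ⟨f.map ρ.toRingHom, fun h0 => hk ?_, ?_⟩
          · have := congrArg (fun g => g.coeff k) h0
            simp only [Polynomial.coeff_map, Polynomial.coeff_zero] at this
            exact (hev _).1 (congrArg Subtype.val this)
          · rw [← hev] at hf
            rw [← hf, Polynomial.aeval_def, Polynomial.aeval_def, Polynomial.eval₂_map]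
            exact (Polynomial.hom_eval₂ f (algebraMap _ _) (ev : MvPolynomial V R →+* L) (X v)).symm
        exact halg.restrictScalars B
      · exact isAlgebraic_algebraMap (⟨_, Algebra.subset_adjoin ⟨⟨v, hv⟩, rfl⟩⟩ : B)
  have : (⊤ : Subalgebra R (MvPolynomial V R)) ≤ T.comap ev := by
    rw [← MvPolynomial.adjoin_range_X]
    refine Algebra.adjoin_le ?_
    rintro _ ⟨v, rfl⟩
    exact hX v
  exact this (Algebra.mem_top (x := p))

/-- Let `P` be a prime differential ideal of a ring of differential polynomials over `R` which
contains no nonzero constants, and let `b ∉ P`. The homomorphisms from `R` to an algebraically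
closed field which do not vanish on a certain nonzero `a : R` extend to homomorphisms vanishing on
`P` but not on `b`. -/
theorem IsRanked.exists_specialization [Algebra ℚ R] [IsDomain R] [WellFoundedLT V]
    (hd : IsRanked d δ) (P : Ideal (MvPolynomial V R)) [P.IsPrime] (hP : P.IsStable d)
    (hC : ∀ r, C r ∈ P → r = 0) {b : MvPolynomial V R} (hb : b ∉ P) :
    ∃ a : R, a ≠ 0 ∧ ∀ {k : Type u} [Field k] [IsAlgClosed k] (φ : R →+* k), φ a ≠ 0 →
      ∃ ψ : MvPolynomial V R →+* k, (∀ r, ψ (C r) = φ r) ∧ (∀ p ∈ P, ψ p = 0) ∧ ψ b ≠ 0 := by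
  classical
  let L := FractionRing (MvPolynomial V R ⧸ P)
  let ev : MvPolynomial V R →ₐ[R] L :=
    (IsScalarTower.toAlgHom R (MvPolynomial V R ⧸ P) L).comp (Ideal.Quotient.mkₐ R P)
  have hev : ∀ p, ev p = 0 ↔ p ∈ P := by
    intro p
    change algebraMap (MvPolynomial V R ⧸ P) L (Ideal.Quotient.mk P p) = 0 ↔ _
    rw [map_eq_zero_iff _ (IsFractionRing.injective _ _), Ideal.Quotient.eq_zero_iff_mem]
  have : FaithfulSMul R L := by
    refine (faithfulSMul_iff_algebraMap_injective _ _).2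
      ((injective_iff_map_eq_zero _).2 fun r hr => hC r ((hev _).1 ?_))
    rw [← hr, ← ev.commutes]
    rfl
  have hf : ∀ v : V, ∃ f : Polynomial (below R v), IsLeader P v → IsMinimalRelation P f := by
    intro v
    by_cases hv : IsLeader P v
    · obtain ⟨f, hf⟩ := hv.exists_isMinimalRelation
      exact ⟨f, fun _ => hf⟩
    · exact ⟨0, fun h => absurd h hv⟩
  choose f hf using hf
  set M := (hd.finite_minimalLeaders P).toFinset
  have hML : ∀ v ∈ M, IsMinimalRelation P (f v) := fun v hv =>
    hf v ((Set.Finite.mem_toFinset _).1 hv).1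
  let s : V → MvPolynomial V R := fun v =>
    Polynomial.aeval (X v : MvPolynomial V R) (Polynomial.derivative (f v))
  have hs : ∀ v ∈ M, s v ∉ P := fun v hv => (hML v hv).aeval_derivative_notMem
  -- With the separants inverted, the linear relations express each remaining leader through lower
  -- variables, so these finitely many elements and the non-leaders generate all residues. The
  -- inverse of `b` forces its image to be nonzero.
  let c : Finset L := insert (ev b)⁻¹ (M.image (fun v => ev (X v)) ∪ M.image fun v => (ev (s v))⁻¹)
  have halg := isAlgebraic_adjoin_nonleaders ev hev
  obtain ⟨a, ha0, ha⟩ := (algebraicIndependent_nonleaders hC ev hev).exists_extension c (by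
    intro x hx
    simp only [c, Finset.mem_insert, Finset.mem_union, Finset.mem_image] at hx
    rcases hx with rfl | ⟨v, -, rfl⟩ | ⟨v, -, rfl⟩
    · exact (halg b).inv
    · exact halg _
    · exact (halg _).inv)
  refine ⟨a, ha0, fun {k} _ _ φ hφ => ?_⟩
  let T : Subalgebra R L :=
    Algebra.adjoin R (Set.range (fun v : {v // ¬ IsLeader P v} => ev (X v.1)) ∪ c)
  obtain ⟨ψ, hψ⟩ : ∃ ψ : T →+* k, ∀ r, ψ (algebraMap R T r) = φ r := ha φ hφ
  have hX : ∀ v, ev (X v) ∈ T := by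
    intro v
    induction v using WellFoundedLT.induction with
    | ind v ih =>
      by_cases hv : IsLeader P v
      · have hle : ∀ q ∈ below R v, ev q ∈ T := by
          intro q hq
          change q ∈ supported R _ at hq
          rw [supported_eq_adjoin_X] at hq
          have : Algebra.adjoin R (X '' Set.Iio v) ≤ T.comap ev := by
            refine Algebra.adjoin_le ?_
            rintro _ ⟨u, hu, rfl⟩
            exact ih u hu
          exact this hq
        obtain ⟨u, hu, huv⟩ := hd.exists_minimalLeader hv
        have huM : u ∈ M := (Set.Finite.mem_toFinset _).2 hu
        rcases Relation.reflTransGen_iff_eq_or_transGen.1 huv with rfl | huv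
        · refine Algebra.subset_adjoin (Or.inr ?_)
          simp only [c, Finset.coe_insert, Finset.coe_union, Finset.coe_image]
          exact Or.inr (Or.inl ⟨_, huM, rfl⟩)
        · obtain ⟨-, r, hr, hI⟩ := hd.exists_linear (f u) huv
          have h0 := (hev _).2 (hI P hP (hML u huM).mem)
          rw [map_add, map_mul] at h0
          have hsu : ev (s u) ≠ 0 := fun h => hs u huM ((hev _).1 h)
          have : ev (X v) = (ev (s u))⁻¹ * -(ev r) := by
            rw [← eq_neg_of_add_eq_zero_left h0, inv_mul_cancel_left₀ hsu]
          rw [this]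
          refine T.mul_mem (Algebra.subset_adjoin (Or.inr ?_)) (T.neg_mem (hle r hr))
          simp only [c, Finset.coe_insert, Finset.coe_union, Finset.coe_image]
          exact Or.inr (Or.inr ⟨_, huM, rfl⟩)
      · exact Algebra.subset_adjoin (Or.inl ⟨⟨v, hv⟩, rfl⟩)
  have hevT : ∀ p, ev p ∈ T := by
    have : (⊤ : Subalgebra R (MvPolynomial V R)) ≤ T.comap ev := by
      rw [← MvPolynomial.adjoin_range_X]
      refine Algebra.adjoin_le ?_
      rintro _ ⟨v, rfl⟩
      exact hX v
    exact fun p => this (Algebra.mem_top (x := p))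
  refine ⟨ψ.comp (ev.codRestrict T hevT).toRingHom, fun r => ?_, fun p hp => ?_, fun h0 => ?_⟩
  · rw [← hψ]
    exact congrArg ψ (a₁ := ev.codRestrict T hevT (C r)) (a₂ := algebraMap R T r)
      (Subtype.ext (ev.commutes r))
  · rw [RingHom.comp_apply, show (ev.codRestrict T hevT).toRingHom p = 0 from
      Subtype.ext ((hev p).2 hp), map_zero]
  · have hbT : (ev b)⁻¹ ∈ T := Algebra.subset_adjoin (Or.inr (by simp [c]))
    have h1 : (ev.codRestrict T hevT).toRingHom b * ⟨(ev b)⁻¹, hbT⟩ = 1 :=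
      Subtype.ext (mul_inv_cancel₀ fun h => hb ((hev b).1 h))
    have h2 := congrArg ψ h1
    rw [map_mul, map_one] at h2
    rw [RingHom.comp_apply] at h0
    rw [h0, zero_mul] at h2
    exact zero_ne_one h2

end Specialization

/-! ### Radical and prime differential ideals -/

section StableIdeals

variable {A ι : Type*} [CommRing A] {d : ι → SelfDerivation A}

theorem Ideal.IsStable.radical [Algebra ℚ A] {I : Ideal A} (hI : I.IsStable d) :
    I.radical.IsStable d := by
  rintro i x ⟨n, hn⟩
  -- Differentiating `x ^ (m+1) * (d i x) ^ j` and multiplying by `d i x` gives `(m+1) * x ^ m * (d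
  -- i x) ^ (j+2)` modulo `I`: each power of `x` is traded for two of `d i x`, after division by
  -- `m+1`.
  have key : ∀ m j : ℕ, x ^ m * d i x ^ j ∈ I → ∃ k, d i x ^ k ∈ I := by
    intro m
    induction m with
    | zero => exact fun j hj => ⟨j, by simpa using hj⟩
    | succ m ih =>
      intro j hj
      refine ih (j + 2) ?_
      have h1 := I.mul_mem_left (d i x) (hI i _ hj)
      rw [Derivation.leibniz, Derivation.leibniz_pow, Derivation.leibniz_pow] at h1
      simp only [smul_eq_mul, nsmul_eq_mul, add_tsub_cancel_right] at h1
      have h2 : ((m + 1 : ℕ) : A) * (x ^ m * d i x ^ (j + 2)) ∈ I := by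
        rcases j with _ | j
        · convert h1 using 1
          push_cast
          ring
        · have h3 := I.mul_mem_left ((j + 1 : ℕ) * d i (d i x)) hj
          convert I.sub_mem h1 h3 using 1
          rw [Nat.add_sub_cancel]
          ring
      have h4 := I.mul_mem_left (algebraMap ℚ A (m + 1 : ℕ)⁻¹) h2
      rwa [← mul_assoc, ← map_natCast (algebraMap ℚ A), ← map_mul,
        inv_mul_cancel₀ (by exact_mod_cast Nat.succ_ne_zero m), map_one, one_mul] at h4
  exact key n 0 (by simpa using hn)

/-- A differential ideal of a `ℚ`-algebra disjoint from the powers of `b` is contained in a prime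
differential ideal not containing `b`. -/
theorem Ideal.IsStable.exists_le_prime [Algebra ℚ A] {I : Ideal A} (hI : I.IsStable d) {b : A}
    (hb : ∀ n : ℕ, b ^ n ∉ I) :
    ∃ Q : Ideal A, Q.IsPrime ∧ Q.IsStable d ∧ I ≤ Q ∧ b ∉ Q := by
  obtain ⟨Q, hIQ, hmax⟩ := zorn_le_nonempty₀ {J : Ideal A | J.IsStable d ∧ ∀ n : ℕ, b ^ n ∉ J}
    (fun c hc hchain y hy => by
      have hdir := hchain.directedOn
      refine ⟨sSup c, ⟨fun i x hx => ?_, fun n hn => ?_⟩, fun z hz => le_sSup hz⟩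
      · obtain ⟨J, hJ, hxJ⟩ := (Submodule.mem_sSup_of_directed ⟨y, hy⟩ hdir).1 hx
        exact (le_sSup hJ : J ≤ sSup c) ((hc hJ).1 i x hxJ)
      · obtain ⟨J, hJ, hnJ⟩ := (Submodule.mem_sSup_of_directed ⟨y, hy⟩ hdir).1 hn
        exact (hc hJ).2 n hnJ) I ⟨hI, hb⟩
  have hst : Q.IsStable d := hmax.prop.1
  have hbQ : ∀ n : ℕ, b ^ n ∉ Q := hmax.prop.2
  have hrad : Q.radical ≤ Q := hmax.2 ⟨hst.radical, fun n hn => by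
    obtain ⟨k, hk⟩ := hn
    exact hbQ (n * k) (pow_mul b n k ▸ hk)⟩ Ideal.le_radical
  -- Since `Q` is radical, the colon ideal of `Q` by `a` is again stable. It contains `Q` and also
  -- `y`, so maximality forces it to contain a power of `b`.
  have hcolon : ∀ a : A, ∀ y, y * a ∈ Q → y ∉ Q → ∃ n : ℕ, b ^ n * a ∈ Q := by
    intro a y hya hy
    let J : Ideal A :=
      { carrier := {x | x * a ∈ Q}
        add_mem' := fun {x z} hx hz => by
          simpa only [Set.mem_ofPred_eq, add_mul] using Q.add_mem hx hz
        zero_mem' := by simp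
        smul_mem' := fun r x hx => by
          simpa only [Set.mem_ofPred_eq, smul_eq_mul, mul_assoc] using Q.mul_mem_left r hx }
    by_contra! hn
    have hJ : J.IsStable d := by
      intro i x hx
      -- The square of `d i x * a` is `a * d i x * d i (x * a)` minus a multiple of `x * a`.
      refine hrad ⟨2, ?_⟩
      have h1 := Q.mul_mem_left (a * d i x) (hst i _ hx)
      rw [Derivation.leibniz, smul_eq_mul, smul_eq_mul] at h1
      have h2 := Q.mul_mem_left (d i a * d i x) hx
      convert Q.sub_mem h1 h2 using 1
      ring
    exact hy (hmax.2 ⟨hJ, hn⟩ (fun x hx => Q.mul_mem_right a hx) hya)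
  refine ⟨Q, ⟨?_, ?_⟩, hst, hIQ, by simpa using hbQ 1⟩
  · rintro rfl
    exact hbQ 0 trivial
  · intro x y hxy
    by_contra! h
    obtain ⟨n, hn⟩ := hcolon y x hxy h.1
    obtain ⟨k, hk⟩ := hcolon (b ^ n) y (mul_comm y (b ^ n) ▸ hn) h.2
    exact hbQ (k + n) (pow_add b k n ▸ hk)

/-- The ideal generated by a set stable under derivations is stable. -/
theorem Ideal.isStable_span {s : Set A} (hs : ∀ i, ∀ x ∈ s, d i x ∈ Ideal.span s) :
    (Ideal.span s).IsStable d := by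
  intro i x hx
  induction hx using Submodule.span_induction with
  | mem x hx => exact hs i x hx
  | zero => rw [map_zero]; exact Submodule.zero_mem _
  | add x y _ _ hx hy => rw [map_add]; exact Submodule.add_mem _ hx hy
  | smul a x hx hx' =>
    rw [smul_eq_mul, Derivation.leibniz, smul_eq_mul, smul_eq_mul]
    exact Ideal.add_mem _ (Ideal.mul_mem_left _ _ hx') (Ideal.mul_mem_right _ _ hx)

end StableIdeals

/-! ### Extending derivations, viewed as homomorphisms to dual numbers -/

section Extensions

open TrivSqZeroExt

variable {A B : Type*} [CommRing A] [CommRing B]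

/-- The ring homomorphism `a ↦ f a + ε f (D a)` given by a derivation `D`. -/
def SelfDerivation.toTrivSqZeroExt (D : SelfDerivation A) (f : A →+* B) :
    A →+* TrivSqZeroExt B B where
  toFun a := inl (f a) + inr (f (D a))
  map_one' := by ext <;> simp
  map_mul' x y := by
    ext
    · simp
    · simp [mul_comm]
  map_zero' := by ext <;> simp
  map_add' x y := by ext <;> simp

@[simp]
theorem SelfDerivation.fst_toTrivSqZeroExt (D : SelfDerivation A) (f : A →+* B) (a : A) :
    (D.toTrivSqZeroExt f a).fst = f a := by
  simp [toTrivSqZeroExt]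

@[simp]
theorem SelfDerivation.snd_toTrivSqZeroExt (D : SelfDerivation A) (f : A →+* B) (a : A) :
    (D.toTrivSqZeroExt f a).snd = f (D a) := by
  simp [toTrivSqZeroExt]

/-- The derivation given by a section of the projection of the dual numbers. -/
def SelfDerivation.ofSection (f : B →+* TrivSqZeroExt B B) (hf : ∀ b, (f b).fst = b) :
    SelfDerivation B :=
  Derivation.mk'
    { toFun := fun b => (f b).snd
      map_add' := fun x y => by simp
      map_smul' := fun n x => by simp }
    (fun x y => by simp [hf, mul_comm])

theorem SelfDerivation.ofSection_apply (f : B →+* TrivSqZeroExt B B) (hf : ∀ b, (f b).fst = b)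
    (b : B) : SelfDerivation.ofSection f hf b = (f b).snd := rfl

/-- The derivation of a polynomial ring extending a derivation of the constants, with prescribed
values at the variables. -/
noncomputable def SelfDerivation.mvPolynomial {σ : Type*} (D : SelfDerivation A)
    (g : σ → MvPolynomial σ A) : SelfDerivation (MvPolynomial σ A) :=
  SelfDerivation.ofSection
    (eval₂Hom (D.toTrivSqZeroExt C) fun v => inl (X v) + inr (g v)) (fun p => by
      induction p using MvPolynomial.induction_on with
      | C a => simp
      | add p q hp hq => rw [map_add, fst_add, hp, hq]
      | mul_X p v hp => rw [map_mul, fst_mul, hp]; simp)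

@[simp]
theorem SelfDerivation.mvPolynomial_C {σ : Type*} (D : SelfDerivation A)
    (g : σ → MvPolynomial σ A) (a : A) : D.mvPolynomial g (C a) = C (D a) := by
  simp [mvPolynomial, ofSection_apply]

@[simp]
theorem SelfDerivation.mvPolynomial_X {σ : Type*} (D : SelfDerivation A)
    (g : σ → MvPolynomial σ A) (v : σ) : D.mvPolynomial g (X v) = g v := by
  simp [mvPolynomial, ofSection_apply]

/-- The derivation of a quotient by a stable ideal. -/
def SelfDerivation.quotient (D : SelfDerivation A) (I : Ideal A) (hI : ∀ x ∈ I, D x ∈ I) :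
    SelfDerivation (A ⧸ I) :=
  SelfDerivation.ofSection
    (Ideal.Quotient.lift I (D.toTrivSqZeroExt (Ideal.Quotient.mk I)) fun x hx => by
      ext
      · simpa using Ideal.Quotient.eq_zero_iff_mem.2 hx
      · simpa using Ideal.Quotient.eq_zero_iff_mem.2 (hI x hx)) (fun x => by
      obtain ⟨x, rfl⟩ := Ideal.Quotient.mk_surjective x
      simp)

@[simp]
theorem SelfDerivation.quotient_mk (D : SelfDerivation A) (I : Ideal A) (hI : ∀ x ∈ I, D x ∈ I)
    (x : A) : D.quotient I hI (Ideal.Quotient.mk I x) = Ideal.Quotient.mk I (D x) := by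
  simp [quotient, ofSection_apply]

/-- The derivation of the field of fractions. -/
noncomputable def SelfDerivation.fractionRing (D : SelfDerivation A) (F : Type*) [Field F]
    [Algebra A F] [IsFractionRing A F] :
    SelfDerivation F :=
  SelfDerivation.ofSection
    (IsLocalization.lift (M := nonZeroDivisors A) (S := F)
      (g := D.toTrivSqZeroExt (algebraMap A F)) fun s => by
        rw [isUnit_iff_isUnit_fst, fst_toTrivSqZeroExt]
        exact IsLocalization.map_units _ s) (fun x => by
      have : (fstHom F F F).toRingHom.comp
          (IsLocalization.lift (M := nonZeroDivisors A) (S := F)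
            (g := D.toTrivSqZeroExt (algebraMap A F)) fun s => by
            rw [isUnit_iff_isUnit_fst, fst_toTrivSqZeroExt]
            exact IsLocalization.map_units _ s) = RingHom.id _ := by
        refine IsLocalization.ringHom_ext (nonZeroDivisors A) ?_
        ext a
        simp
      exact congrArg (fun f => f x) this)

@[simp]
theorem SelfDerivation.fractionRing_algebraMap (D : SelfDerivation A) (F : Type*) [Field F]
    [Algebra A F] [IsFractionRing A F] (a : A) :
    D.fractionRing F (algebraMap A F a) = algebraMap A F (D a) :=
  (congrArg snd (IsLocalization.lift_eq (M := nonZeroDivisors A) _ a)).trans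
    (D.snd_toTrivSqZeroExt _ a)

/-- Meant for commutators, which are derivations: extended derivations commute as soon as they
commute on `A`. -/
theorem SelfDerivation.eq_zero_of_fractionRing [IsDomain A] {F : Type*} [Field F] [Algebra A F]
    [IsFractionRing A F] {D : SelfDerivation F}
    (h : ∀ a, D (algebraMap A F a) = 0) : D = 0 := by
  refine Derivation.ext fun x => ?_
  obtain ⟨a, s, hs, rfl⟩ := IsFractionRing.div_surjective (A := A) x
  have hs0 : algebraMap A F s ≠ 0 :=
    IsFractionRing.to_map_ne_zero_of_mem_nonZeroDivisors hs
  have h1 := h a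
  rw [← div_mul_cancel₀ (algebraMap A F a) hs0, Derivation.leibniz, h s, smul_zero,
    zero_add, smul_eq_mul] at h1
  exact (mul_eq_zero.1 h1).resolve_left hs0

theorem SelfDerivation.mvPolynomial_eq_zero {σ : Type*} {D : SelfDerivation (MvPolynomial σ A)}
    (hC : ∀ a, D (C a) = 0) (hX : ∀ v, D (X v) = 0) : D = 0 := by
  refine Derivation.ext fun p => ?_
  rw [Derivation.zero_apply]
  induction p using MvPolynomial.induction_on with
  | C a => exact hC a
  | add p q hp hq => rw [map_add, hp, hq, add_zero]
  | mul_X p v hp => rw [Derivation.leibniz, hX, hp]; simp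

end Extensions

/-! ### The operators `theta e` -/

section Operators

variable {N : ℕ}

theorem List.mul_prod_ofFn_pow {M : Type*} [Monoid M] :
    ∀ {n : ℕ} (f : Fin n → M) (_ : ∀ i j, Commute (f i) (f j)) (e : Fin n → ℕ) (i : Fin n),
      f i * (List.ofFn fun k => f k ^ e k).prod =
        (List.ofFn fun k => f k ^ (e + (Pi.single i 1 : Fin n → ℕ)) k).prod := by
  intro n
  induction n with
  | zero => exact fun f _ e i => i.elim0
  | succ n ih =>
    intro f hf e i
    rw [List.ofFn_succ, List.ofFn_succ, List.prod_cons, List.prod_cons]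
    induction i using Fin.cases with
    | zero =>
      rw [← mul_assoc, ← pow_succ']
      simp
    | succ i =>
      have := ih (fun k => f k.succ) (fun i j => hf _ _) (fun k => e k.succ) i
      rw [← mul_assoc, ((hf i.succ 0).pow_right (e 0)).eq, mul_assoc, this]
      congr 2
      ext k
      simp [Pi.single_apply, Fin.succ_inj]

namespace DeltaRing

theorem der_theta {B : Type*} [CommRing B] [DeltaRing N B] (i : Fin N) (e : Fin N → ℕ) (x : B) :
    der i (theta e x) = theta (e + Pi.single i 1) x := by
  have := List.mul_prod_ofFn_pow (fun i : Fin N => ((der i : Derivation ℤ B B) : Module.End ℤ B))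
    (fun i j => LinearMap.ext fun x => der_comm i j x) e i
  exact congrArg (fun f => f x) this

theorem theta_zero {B : Type*} [CommRing B] [DeltaRing N B] (x : B) :
    theta (0 : Fin N → ℕ) x = x := by
  simp [theta]

/-- An induction principle for the operators `theta e`. -/
theorem theta_induction {motive : (Fin N → ℕ) → Prop} (zero : motive 0)
    (add_single : ∀ e i, motive e → motive (e + Pi.single i 1)) (e : Fin N → ℕ) : motive e := by
  induction hn : ∑ i, e i generalizing e with
  | zero =>
    have : e = 0 := funext fun i => (Finset.sum_eq_zero_iff.1 hn) i (Finset.mem_univ i)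
    exact this ▸ zero
  | succ n ih =>
    obtain ⟨i, -, hi⟩ : ∃ i ∈ Finset.univ, e i ≠ 0 := by
      by_contra! h
      rw [Finset.sum_eq_zero h] at hn
      omega
    have he : (e - Pi.single i 1) + Pi.single i 1 = e := by
      ext k
      by_cases hk : k = i
      · subst hk
        simp
        omega
      · simp [hk]
    rw [← he]
    refine add_single _ i (ih _ ?_)
    have h1 := congrArg (fun f => ∑ k, f k) he
    simp only [Pi.add_apply, Finset.sum_add_distrib, Finset.sum_pi_single', Finset.mem_univ,
      if_true] at h1
    omega

end DeltaRing

theorem IsDeltaHom.map_theta {A B : Type*} [CommRing A] [CommRing B] [DeltaRing N A]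
    [DeltaRing N B] {f : A →+* B} (hf : IsDeltaHom N f) (e : Fin N → ℕ) (x : A) :
    f (DeltaRing.theta e x) = DeltaRing.theta e (f x) := by
  induction e using DeltaRing.theta_induction with
  | zero => rw [DeltaRing.theta_zero, DeltaRing.theta_zero]
  | add_single e i ih => rw [← DeltaRing.der_theta, hf, ih, DeltaRing.der_theta]

end Operators

/-! ### Differential polynomials and their ranking -/

section DeltaPolynomials

variable {N m : ℕ} {R : Type*} [CommRing R]

/-- The effect of `∂ᵢ` on the differential variables. -/
def shift (i : Fin N) (v : Fin m × (Fin N → ℕ)) : Fin m × (Fin N → ℕ) :=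
  (v.1, v.2 + Pi.single i 1)

/-- The ring of differential polynomials is a differential ring. -/
noncomputable instance DeltaPolynomial.instDeltaRing [DeltaRing N R] :
    DeltaRing N (DeltaPolynomial N m R) where
  der i := SelfDerivation.mvPolynomial (DeltaRing.der i) fun v => X (shift i v)
  der_comm i j p := by
    have h : ⁅SelfDerivation.mvPolynomial (DeltaRing.der i : SelfDerivation R)
          fun v : Fin m × (Fin N → ℕ) => X (shift i v),
        SelfDerivation.mvPolynomial (DeltaRing.der j : SelfDerivation R)
          fun v : Fin m × (Fin N → ℕ) => X (shift j v)⁆ = 0 := by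
      refine SelfDerivation.mvPolynomial_eq_zero (fun a => ?_) fun v => ?_
      · rw [Derivation.commutator_apply]
        simp [DeltaRing.der_comm i j a]
      · rw [Derivation.commutator_apply]
        simp [shift, add_right_comm]
    have h1 := congrArg (fun D => D p) h
    rw [Derivation.commutator_apply] at h1
    exact sub_eq_zero.1 h1

theorem DeltaPolynomial.der_C [DeltaRing N R] (i : Fin N) (r : R) :
    DeltaRing.der i (C r : DeltaPolynomial N m R) = C (DeltaRing.der i r) :=
  SelfDerivation.mvPolynomial_C _ _ r

theorem DeltaPolynomial.der_X [DeltaRing N R] (i : Fin N) (v : Fin m × (Fin N → ℕ)) :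
    DeltaRing.der i (X v : DeltaPolynomial N m R) = X (shift i v) :=
  SelfDerivation.mvPolynomial_X _ _ v

/-- A homomorphism from differential polynomials commutes with the derivations if it does so on
constants and on variables. -/
theorem DeltaPolynomial.isDeltaHom [DeltaRing N R] {B : Type*} [CommRing B] [DeltaRing N B]
    {f : DeltaPolynomial N m R →+* B}
    (hC : ∀ (i : Fin N) r, f (C (DeltaRing.der i r)) = DeltaRing.der i (f (C r)))
    (hX : ∀ (i : Fin N) v, f (X (shift i v)) = DeltaRing.der i (f (X v))) : IsDeltaHom N f := by
  intro i p
  induction p using MvPolynomial.induction_on with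
  | C a => rw [der_C, hC]
  | add p q hp hq => simp only [map_add, hp, hq]
  | mul_X p v hp =>
    rw [Derivation.leibniz, map_mul, Derivation.leibniz, map_add, der_X]
    simp only [smul_eq_mul, map_mul, hp, hX]

/-- Evaluation of differential polynomials as an algebra homomorphism. -/
noncomputable def DeltaPolynomial.evalHom {B : Type*} [CommRing B] [Algebra R B] [DeltaRing N B]
    (a : Fin m → B) : DeltaPolynomial N m R →ₐ[R] B :=
  MvPolynomial.aeval fun v : Fin m × (Fin N → ℕ) => DeltaRing.theta v.2 (a v.1)

theorem DeltaPolynomial.evalHom_apply {B : Type*} [CommRing B] [Algebra R B] [DeltaRing N B]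
    (a : Fin m → B) (p : DeltaPolynomial N m R) : evalHom a p = p.evalAt a := rfl

theorem DeltaPolynomial.evalHom_X {B : Type*} [CommRing B] [Algebra R B] [DeltaRing N B]
    (a : Fin m → B) (v : Fin m × (Fin N → ℕ)) :
    evalHom (N := N) (R := R) a (X v) = DeltaRing.theta v.2 (a v.1) :=
  MvPolynomial.aeval_X _ v

theorem DeltaPolynomial.isDeltaHom_evalHom [DeltaRing N R] {B : Type*} [CommRing B] [Algebra R B]
    [DeltaRing N B] (hB : IsDeltaHom N (algebraMap R B)) (a : Fin m → B) :
    IsDeltaHom N (evalHom (N := N) (R := R) a : DeltaPolynomial N m R →+* B) := by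
  refine isDeltaHom (fun i r => ?_) fun i v => ?_
  · change evalHom a (algebraMap R _ _) = DeltaRing.der i (evalHom a (algebraMap R _ _))
    rw [AlgHom.commutes, AlgHom.commutes, hB]
  · change evalHom a (X _) = DeltaRing.der i (evalHom a (X _))
    rw [evalHom_X, evalHom_X, DeltaRing.der_theta]
    rfl

/-- A homomorphism of differential algebras commutes with evaluation. -/
theorem DeltaPolynomial.map_evalAt {B B' : Type*} [CommRing B] [CommRing B'] [Algebra R B]
    [Algebra R B'] [DeltaRing N B] [DeltaRing N B'] (f : B →ₐ[R] B')
    (hf : IsDeltaHom N (f : B →+* B')) (a : Fin m → B) (p : DeltaPolynomial N m R) :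
    f (p.evalAt a) = p.evalAt fun j => f (a j) := by
  rw [← evalHom_apply, ← evalHom_apply, ← AlgHom.comp_apply]
  congr 1
  ext v
  rw [AlgHom.comp_apply, evalHom_X, evalHom_X]
  exact hf.map_theta _ _

theorem IsDeltaHom.isStable_ker {A B : Type*} [CommRing A] [CommRing B] [DeltaRing N A]
    [DeltaRing N B] {f : A →+* B} (hf : IsDeltaHom N f) :
    (RingHom.ker f).IsStable (DeltaRing.der (N := N)) := by
  intro i x hx
  rw [RingHom.mem_ker] at hx ⊢
  rw [hf, hx, map_zero]

theorem reflTransGen_shift_of_le (j : Fin m) {e e' : Fin N → ℕ} (h : e ≤ e') :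
    Relation.ReflTransGen (fun v w : Fin m × (Fin N → ℕ) => ∃ i, shift i v = w) (j, e) (j, e') := by
  obtain ⟨k, rfl⟩ := exists_add_of_le h
  clear h
  induction k using DeltaRing.theta_induction with
  | zero => rw [add_zero]
  | add_single k i ih => exact ih.tail ⟨i, by rw [shift, add_assoc]⟩

/-- The differential variables have a ranking. -/
theorem DeltaPolynomial.exists_isRanked [DeltaRing N R] :
    ∃ (o : LinearOrder (Fin m × (Fin N → ℕ))) (_ : @WellFoundedLT _ o.toLT),
      IsRanked (R := R) (DeltaRing.der (N := N) (R := DeltaPolynomial N m R)) shift := by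
  -- Lexicographic ranking: first the index of the unknown, then the exponents. Adding a fixed
  -- exponent vector preserves it.
  let g : Fin m × (Fin N → ℕ) → Fin m ×ₗ Lex (Fin N → ℕ) := fun v => toLex (v.1, toLex v.2)
  have hg : Function.Injective g := fun v w h => h
  let o : LinearOrder (Fin m × (Fin N → ℕ)) := LinearOrder.lift' g hg
  have hlt : ∀ v w, o.toLT.lt v w ↔ g v < g w := fun v w => Iff.rfl
  have : WellFoundedLT (Fin m ×ₗ Lex (Fin N → ℕ)) :=
    ⟨WellFounded.prod_lex wellFounded_lt wellFounded_lt⟩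
  refine ⟨o, ⟨InvImage.wf g this.wf⟩, ?_⟩
  refine @IsRanked.mk _ _ _ _ o _ _ (fun i v => der_X i v) (fun i r => ⟨_, der_C i r⟩) ?_ ?_ ?_
  · intro i v w h
    rw [hlt] at h ⊢
    rw [Prod.Lex.toLex_lt_toLex] at h ⊢
    rcases h with h | ⟨h1, k, h2, h3⟩
    · exact Or.inl h
    · refine Or.inr ⟨h1, k, fun l hl => ?_, ?_⟩
      · exact congrArg (· + (Pi.single i 1 : Fin N → ℕ) l) (h2 l hl)
      · exact Nat.add_lt_add_right h3 ((Pi.single i 1 : Fin N → ℕ) k)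
  · intro i v
    rw [hlt]
    rw [Prod.Lex.toLex_lt_toLex]
    refine Or.inr ⟨rfl, i, fun l hl => ?_, ?_⟩
    · change v.2 l = v.2 l + (Pi.single i 1 : Fin N → ℕ) l
      rw [Pi.single_eq_of_ne hl.ne, add_zero]
    · change v.2 i < v.2 i + (Pi.single i 1 : Fin N → ℕ) i
      rw [Pi.single_eq_same]
      exact Nat.lt_succ_self _
  -- Dickson's lemma: for the same unknown, componentwise comparison of exponents means being a
  -- derivative.
  · have h1 : WellQuasiOrdered fun a b : Fin m × (Fin N → ℕ) => a.1 = b.1 ∧ a.2 ≤ b.2 :=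
      (Finite.wellQuasiOrdered (α := Fin m) (· = ·)).prod wellQuasiOrdered_le
    intro f
    obtain ⟨k, l, hkl, h2, h3⟩ := h1 f
    refine ⟨k, l, hkl, ?_⟩
    have := reflTransGen_shift_of_le (f k).1 h3
    convert this using 2
    exact h2.symm

end DeltaPolynomials

/-! ### Zeros and extension of homomorphisms over a differentially closed field -/

section DifferentiallyClosed

variable {N : ℕ}

/-- The quotient of a differential ring by a differential ideal. -/
abbrev Ideal.IsStable.deltaRing {A : Type*} [CommRing A] [DeltaRing N A] {I : Ideal A}
    (hI : I.IsStable (DeltaRing.der (N := N))) : DeltaRing N (A ⧸ I) where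
  der i := SelfDerivation.quotient (DeltaRing.der i) I (hI i)
  der_comm i j x := by
    obtain ⟨x, rfl⟩ := Ideal.Quotient.mk_surjective x
    simp [DeltaRing.der_comm i j x]

/-- The field of fractions of a differential domain. -/
noncomputable abbrev DeltaRing.fractionRing (A F : Type*) [CommRing A] [IsDomain A]
    [DeltaRing N A] [Field F] [Algebra A F] [IsFractionRing A F] : DeltaRing N F where
  der i := SelfDerivation.fractionRing (DeltaRing.der i : SelfDerivation A) F
  der_comm i j x := by
    have h : ⁅SelfDerivation.fractionRing (DeltaRing.der i : SelfDerivation A) F,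
        SelfDerivation.fractionRing (DeltaRing.der j : SelfDerivation A) F⁆ = 0 := by
      refine SelfDerivation.eq_zero_of_fractionRing (A := A) fun a => ?_
      rw [Derivation.commutator_apply]
      simp [DeltaRing.der_comm i j a]
    have h1 := congrArg (fun D => D x) h
    rw [Derivation.commutator_apply] at h1
    exact sub_eq_zero.1 h1

theorem DeltaPolynomial.theta_X {m : ℕ} {R : Type*} [CommRing R] [DeltaRing N R] (j : Fin m)
    (e : Fin N → ℕ) : DeltaRing.theta e (X (j, 0) : DeltaPolynomial N m R) = X (j, e) := by
  induction e using DeltaRing.theta_induction with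
  | zero => rw [DeltaRing.theta_zero]
  | add_single e i ih =>
    rw [← DeltaRing.der_theta, ih, der_X]
    rfl

/-- Both sides are algebra homomorphisms in `p`, and they agree on variables because `f` commutes
with `theta`. When `f` is the residue map modulo `Q`, the point is the generic zero of `Q`. -/
theorem DeltaPolynomial.evalAt_generic {m : ℕ} {R B : Type*} [CommRing R] [DeltaRing N R]
    [CommRing B] [DeltaRing N B] [Algebra R B] (f : DeltaPolynomial N m R →ₐ[R] B)
    (hf : IsDeltaHom N (f : DeltaPolynomial N m R →+* B)) (p : DeltaPolynomial N m R) :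
    (p.evalAt fun j => f (X (j, 0))) = f p := by
  rw [← evalHom_apply]
  congr 1
  ext v
  rw [evalHom_X]
  exact (hf.map_theta v.2 (X (v.1, 0))).symm.trans (congrArg f (theta_X v.1 v.2))

/-- Over a differentially closed field, every prime differential ideal has a zero at which a
prescribed differential polynomial outside the ideal does not vanish. -/
theorem IsDifferentiallyClosed.exists_zero {K : Type u} [Field K] [CharZero K] [DeltaRing N K]
    (hK : IsDifferentiallyClosed N K) {m : ℕ} (Q : Ideal (DeltaPolynomial N m K)) [Q.IsPrime]
    (hQ : Q.IsStable (DeltaRing.der (N := N))) {b : DeltaPolynomial N m K} (hb : b ∉ Q) :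
    ∃ a : Fin m → K, (∀ p ∈ Q, p.evalAt a = 0) ∧ b.evalAt a ≠ 0 := by
  obtain ⟨o, ho, hr⟩ := DeltaPolynomial.exists_isRanked (N := N) (m := m) (R := K)
  obtain ⟨A, H, hA, hH, hmin⟩ := @IsRanked.exists_finset_le _ _ _ _ o _ _ _ ho hr Q _ hQ
    (fun r hr => by
      by_contra h0
      exact Ideal.IsPrime.ne_top ‹_› (Ideal.eq_top_of_isUnit_mem _ hr ((IsUnit.mk0 r h0).map C)))
  let _ : DeltaRing N (DeltaPolynomial N m K ⧸ Q) := hQ.deltaRing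
  let L := FractionRing (DeltaPolynomial N m K ⧸ Q)
  let _ : DeltaRing N L := DeltaRing.fractionRing (DeltaPolynomial N m K ⧸ Q) L
  let f : DeltaPolynomial N m K →ₐ[K] L :=
    (IsScalarTower.toAlgHom K (DeltaPolynomial N m K ⧸ Q) L).comp (Ideal.Quotient.mkₐ K Q)
  have hf : IsDeltaHom N (f : DeltaPolynomial N m K →+* L) := fun i x =>
    ((SelfDerivation.fractionRing_algebraMap _ L _).trans
      (congrArg (algebraMap _ L) (SelfDerivation.quotient_mk _ Q _ x))).symm
  have hf0 : ∀ p, f p = 0 ↔ p ∈ Q := by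
    intro p
    change algebraMap (DeltaPolynomial N m K ⧸ Q) L (Ideal.Quotient.mk Q p) = 0 ↔ _
    rw [map_eq_zero_iff _ (IsFractionRing.injective _ _), Ideal.Quotient.eq_zero_iff_mem]
  have hKL : IsDeltaAlgebra N K L := ⟨fun i x => by
    have h1 : ∀ y : K, algebraMap K L y = f (C y) := fun y => (f.commutes y).symm
    rw [h1, h1, ← DeltaPolynomial.der_C]
    exact hf i (C x)⟩
  -- The generic zero solves this finite system. For a solution `a` in `K`, the kernel of evaluation
  -- is a prime differential ideal containing `A` but not `H`, so it contains `Q`.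
  obtain ⟨a, haA, haH⟩ := hK m A {H * b} ⟨L, inferInstance, inferInstance, inferInstance, hKL,
    fun j => f (X (j, 0)), fun p hp => by
      rw [DeltaPolynomial.evalAt_generic f hf]
      exact (hf0 p).2 (hA p hp), fun q hq => by
      rw [Finset.mem_singleton.1 hq, DeltaPolynomial.evalAt_generic f hf, Ne, hf0]
      exact fun h => (Ideal.IsPrime.mem_or_mem ‹_› h).elim hH hb⟩
  have hHb := haH _ (Finset.mem_singleton_self _)
  rw [← DeltaPolynomial.evalHom_apply, map_mul] at hHb
  have hev : IsDeltaHom N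
      (DeltaPolynomial.evalHom (N := N) (R := K) a : DeltaPolynomial N m K →+* K) :=
    DeltaPolynomial.isDeltaHom_evalHom (fun _ _ => rfl) a
  have hle := hmin (RingHom.ker
    (DeltaPolynomial.evalHom (N := N) (R := K) a : DeltaPolynomial N m K →+* K))
    (RingHom.ker_isPrime _) hev.isStable_ker (fun p hp => haA p hp) (left_ne_zero_of_mul hHb)
  exact ⟨a, fun p hp => hle hp, right_ne_zero_of_mul hHb⟩

/-- A differential algebra of finite type is a quotient of a ring of differential polynomials. -/
theorem DeltaFiniteType.exists_evalHom_surjective {A S : Type*} [CommRing A] [CommRing S]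
    [Algebra A S] [DeltaRing N A] [DeltaRing N S] (h : DeltaFiniteType N A S)
    (hAS : IsDeltaHom N (algebraMap A S)) :
    ∃ (m : ℕ) (a : Fin m → S),
      Function.Surjective (DeltaPolynomial.evalHom (N := N) (R := A) a) := by
  obtain ⟨F, hF⟩ := h
  let a : Fin F.card → S := fun j => F.equivFin.symm j
  have hev := DeltaPolynomial.isDeltaHom_evalHom hAS a
  refine ⟨F.card, a, ?_⟩
  rw [← AlgHom.range_eq_top]
  refine hF ⟨(DeltaPolynomial.evalHom (N := N) (R := A) a).range, ?_⟩ fun x hx => ?_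
  · rintro i _ ⟨p, rfl⟩
    exact ⟨DeltaRing.der i p, hev i p⟩
  · refine ⟨X (F.equivFin ⟨x, hx⟩, 0), ?_⟩
    change DeltaPolynomial.evalHom a (X _) = x
    rw [DeltaPolynomial.evalHom_X, DeltaRing.theta_zero]
    simp [a]

theorem DeltaPolynomial.isDeltaHom_map {m : ℕ} {R R' : Type*} [CommRing R] [CommRing R']
    [DeltaRing N R] [DeltaRing N R'] {φ : R →+* R'} (hφ : IsDeltaHom N φ) :
    IsDeltaHom N (MvPolynomial.map φ : DeltaPolynomial N m R →+* DeltaPolynomial N m R') := by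
  refine isDeltaHom (fun i r => ?_) fun i v => ?_
  · rw [map_C, map_C, der_C, hφ]
  · rw [map_X, map_X, der_X]

/-- Extension of specializations from `R` to a differential `R`-algebra of finite type. -/
theorem IsDifferentiallyClosed.exists_extension {K : Type u} [Field K] [CharZero K] [DeltaRing N K]
    (hK : IsDifferentiallyClosed N K) {R S : Type*} [CommRing R] [CommRing S] [IsDomain R]
    [IsDomain S] [Algebra ℚ R] [DeltaRing N R] [DeltaRing N S] [Algebra R S] [FaithfulSMul R S]
    (hRS : IsDeltaHom N (algebraMap R S)) (hfin : DeltaFiniteType N R S) {b : S} (hb : b ≠ 0) :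
    ∃ a : R, a ≠ 0 ∧ ∀ φ : R →+* K, IsDeltaHom N φ → φ a ≠ 0 →
      ∃ ψ : S →+* K, IsDeltaHom N ψ ∧ (∀ r, ψ (algebraMap R S r) = φ r) ∧ ψ b ≠ 0 := by
  obtain ⟨m, y, hy⟩ := hfin.exists_evalHom_surjective hRS
  have hev := DeltaPolynomial.isDeltaHom_evalHom hRS y
  set ev : DeltaPolynomial N m R →+* S :=
    (DeltaPolynomial.evalHom (N := N) (R := R) y : DeltaPolynomial N m R →+* S)
  have hevC : ∀ r, ev (C r) = algebraMap R S r := fun r =>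
    (DeltaPolynomial.evalHom (N := N) (R := R) y).commutes r
  have hP : (RingHom.ker ev).IsPrime := RingHom.ker_isPrime ev
  obtain ⟨β, hβ⟩ : ∃ β, ev β = b := hy b
  obtain ⟨o, ho, hr⟩ := DeltaPolynomial.exists_isRanked (N := N) (m := m) (R := R)
  obtain ⟨a, ha0, ha⟩ := @IsRanked.exists_specialization _ _ _ _ o _ _ _ _ ho hr
    (RingHom.ker ev) _ hev.isStable_ker (fun r hr => by
      rw [RingHom.mem_ker, hevC] at hr
      exact (map_eq_zero_iff _ (FaithfulSMul.algebraMap_injective R S)).1 hr) β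
    (fun h => hb (hβ ▸ h))
  refine ⟨a, ha0, fun φ hφ hφa => ?_⟩
  -- No derivations on the algebraic closure are involved: `χ` only certifies that no power of `Φ β`
  -- lies in the ideal generated by `Φ` of the kernel.
  obtain ⟨χ, hχC, hχP, hχβ⟩ := ha (k := AlgebraicClosure K) ((algebraMap K _).comp φ)
    ((map_ne_zero (algebraMap K (AlgebraicClosure K))).2 hφa)
  let Φ : DeltaPolynomial N m R →+* DeltaPolynomial N m K := MvPolynomial.map φ
  have hΦ : IsDeltaHom N Φ := DeltaPolynomial.isDeltaHom_map hφ
  let χ' : DeltaPolynomial N m K →+* AlgebraicClosure K :=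
    eval₂Hom (algebraMap K _) fun v => χ (X v)
  have hχ' : ∀ p, χ' (Φ p) = χ p := by
    have : χ'.comp Φ = χ := by
      refine MvPolynomial.ringHom_ext (fun r => ?_) fun v => ?_
      · simp [χ', Φ, hχC]
      · simp [χ', Φ]
    exact fun p => congrArg (fun f => f p) this
  have hJ : (Ideal.span (Φ '' (RingHom.ker ev : Set (DeltaPolynomial N m R)))).IsStable
      (DeltaRing.der (N := N)) := by
    refine Ideal.isStable_span ?_
    rintro i _ ⟨p, hp, rfl⟩
    rw [← hΦ]
    exact Ideal.subset_span ⟨_, hev.isStable_ker i p hp, rfl⟩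
  have hJχ : Ideal.span (Φ '' (RingHom.ker ev : Set (DeltaPolynomial N m R))) ≤
      RingHom.ker χ' := by
    refine Ideal.span_le.2 ?_
    rintro _ ⟨p, hp, rfl⟩
    exact (hχ' p).trans (hχP p hp)
  obtain ⟨Q, hQ, hQst, hJQ, hβQ⟩ := hJ.exists_le_prime (b := Φ β) fun n hn => by
    have := hJχ hn
    rw [RingHom.mem_ker, map_pow, hχ'] at this
    exact hχβ (eq_zero_of_pow_eq_zero this)
  obtain ⟨α, hα, hαβ⟩ := hK.exists_zero Q hQst hβQ
  have hevα : IsDeltaHom N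
      (DeltaPolynomial.evalHom (N := N) (R := K) α : DeltaPolynomial N m K →+* K) :=
    DeltaPolynomial.isDeltaHom_evalHom (fun _ _ => rfl) α
  let g : DeltaPolynomial N m R →+* K :=
    (DeltaPolynomial.evalHom (N := N) (R := K) α : DeltaPolynomial N m K →+* K).comp Φ
  have hg : RingHom.ker ev ≤ RingHom.ker g := fun p hp =>
    hα _ (hJQ (Ideal.subset_span ⟨p, hp, rfl⟩))
  have hy' : Function.Surjective ev := hy
  let ψ : S →+* K := ev.liftOfSurjective hy' ⟨g, hg⟩
  have hψ : ∀ p, ψ (ev p) = g p := fun p => ev.liftOfRightInverse_comp_apply _ _ ⟨g, hg⟩ p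
  refine ⟨ψ, fun i x => ?_, fun r => ?_, ?_⟩
  · obtain ⟨p, rfl⟩ := hy' x
    rw [← hev, hψ, hψ]
    exact (congrArg _ (hΦ i p)).trans (hevα i (Φ p))
  · rw [← hevC, hψ]
    change DeltaPolynomial.evalHom α (MvPolynomial.map φ (C r)) = _
    rw [map_C]
    exact (DeltaPolynomial.evalHom (N := N) (R := K) α).commutes (φ r)
  · rw [← hβ, hψ]
    exact hαβ

end DifferentiallyClosed

/-! ### The remaining implications -/

section Equivalences

variable {N : ℕ}

/-- The differential subalgebra generated by a set. -/
def DeltaSubalgebra.adjoin (N : ℕ) (A : Type*) {S : Type*} [CommRing A] [CommRing S] [Algebra A S]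
    [DeltaRing N S] (s : Set S) : DeltaSubalgebra N A S where
  toSubalgebra := sInf {T | ∃ T' : DeltaSubalgebra N A S, T'.toSubalgebra = T ∧
    s ⊆ (T'.toSubalgebra : Set S)}
  der_mem i x hx := by
    rw [Algebra.mem_sInf] at hx ⊢
    rintro _ ⟨T, rfl, hT⟩
    exact T.der_mem i x (hx _ ⟨T, rfl, hT⟩)

theorem DeltaSubalgebra.subset_adjoin {A S : Type*} [CommRing A] [CommRing S] [Algebra A S]
    [DeltaRing N S] (s : Set S) : s ⊆ ((adjoin N A s).toSubalgebra : Set S) := by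
  intro x hx
  refine Algebra.mem_sInf.2 ?_
  rintro _ ⟨T, rfl, hT⟩
  exact hT hx

/-- The image of a differential subalgebra of a differential subalgebra. -/
def DeltaSubalgebra.mapVal {A S : Type*} [CommRing A] [CommRing S] [Algebra A S]
    [DeltaRing N S] {T : DeltaSubalgebra N A S} (U : DeltaSubalgebra N A T.toSubalgebra) :
    DeltaSubalgebra N A S where
  toSubalgebra := U.toSubalgebra.map T.toSubalgebra.val
  der_mem i x hx := by
    obtain ⟨y, hy, rfl⟩ := hx
    exact ⟨DeltaRing.der i y, U.der_mem i y hy, rfl⟩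

/-- A differential subalgebra of the generated one that contains `s` is also one of `S`, so it takes
part in the defining intersection. -/
theorem DeltaSubalgebra.deltaFiniteType_adjoin {A S : Type*} [CommRing A] [CommRing S]
    [Algebra A S] [DeltaRing N S] (s : Finset S) :
    DeltaFiniteType N A (adjoin N A (s : Set S)).toSubalgebra := by
  classical
  refine ⟨s.attach.image fun x : {x // x ∈ s} => ⟨x.1, subset_adjoin _ (Finset.mem_coe.2 x.2)⟩,
    fun U hU => ?_⟩
  refine eq_top_iff.2 ?_
  rintro x -
  have hle : (adjoin N A (s : Set S)).toSubalgebra ≤ (mapVal U).toSubalgebra := by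
    refine sInf_le ⟨mapVal U, rfl, fun y hy => ?_⟩
    exact ⟨⟨y, subset_adjoin _ hy⟩, hU _ (Finset.mem_image.2 ⟨⟨y, hy⟩, Finset.mem_attach _ _, rfl⟩),
      rfl⟩
  obtain ⟨y, hy, hyx⟩ := hle x.2
  have : y = x := Subtype.ext hyx
  exact this ▸ hy

/-- The differential structure on `ULift S`. -/
instance DeltaRing.instULift {S : Type u} [CommRing S] [DeltaRing N S] :
    DeltaRing N (ULift.{v} S) where
  der i := Derivation.mk'
    { toFun := fun x => ⟨DeltaRing.der i x.down⟩
      map_add' := fun x y => ULift.ext _ _ (by simp)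
      map_smul' := fun n x => ULift.ext _ _ (by simp) }
    (fun x y => ULift.ext _ _ (by simp))
  der_comm i j x := ULift.ext _ _ (DeltaRing.der_comm i j x.down)

/-- If every domain of finite type over `K` has a `K`-point, then `K` is differentially closed. -/
theorem IsDifferentiallyClosed.of_exists_point {K : Type u} [Field K] [DeltaRing N K]
    (h : ∀ (S : Type (max u v)) [CommRing S] [IsDomain S] [DeltaRing N S] [Algebra K S]
        [IsDeltaAlgebra N K S], DeltaFiniteType N K S →
        ∃ ψ : S →ₐ[K] K, IsDeltaHom N (ψ : S →+* K)) : IsDifferentiallyClosed N K := by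
  classical
  rintro m P Q ⟨L, _, _, _, hKL, a, hP, hQ⟩
  -- The extension `L` lives in the universe of `K`, whereas the algebras in the hypothesis live in
  -- a possibly larger one.
  let up : L →ₐ[K] ULift.{v} L := (ULift.algEquiv (R := K) (A := L)).symm.toAlgHom
  have hup : IsDeltaHom N (up : L →+* ULift.{v} L) := fun i x => rfl
  -- Adjoining the inverses turns inequations into invertibility, which every homomorphism
  -- preserves.
  let s : Finset (ULift.{v} L) := Finset.univ.image (fun j => up (a j)) ∪
    Q.image fun q => up (q.evalAt a)⁻¹
  let T := DeltaSubalgebra.adjoin N K (s : Set (ULift.{v} L))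
  have hT : IsDeltaAlgebra N K T.toSubalgebra := ⟨fun i x => Subtype.ext <|
    ULift.ext _ _ (hKL.isDeltaHom_algebraMap i x)⟩
  obtain ⟨ψ, hψ⟩ := h T.toSubalgebra (DeltaSubalgebra.deltaFiniteType_adjoin s)
  have ha : ∀ j, up (a j) ∈ T.toSubalgebra := fun j =>
    DeltaSubalgebra.subset_adjoin _ (by simp [s])
  have hinv : ∀ q ∈ Q, up (q.evalAt a)⁻¹ ∈ T.toSubalgebra := fun q hq =>
    DeltaSubalgebra.subset_adjoin _ (Finset.mem_coe.2 (Finset.mem_union_right _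
      (Finset.mem_image_of_mem _ hq)))
  let y : Fin m → T.toSubalgebra := fun j => ⟨up (a j), ha j⟩
  have hval : ∀ p : DeltaPolynomial N m K, ((p.evalAt y : T.toSubalgebra) : ULift.{v} L) =
      up (p.evalAt a) := fun p => by
    rw [DeltaPolynomial.map_evalAt up hup]
    exact DeltaPolynomial.map_evalAt T.toSubalgebra.val (fun _ _ => rfl) y p
  refine ⟨fun j => ψ (y j), fun p hp => ?_, fun q hq => ?_⟩
  · rw [← DeltaPolynomial.map_evalAt ψ hψ,
      show p.evalAt y = 0 from Subtype.ext (by rw [hval, hP p hp, map_zero]; rfl), map_zero]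
  · rw [← DeltaPolynomial.map_evalAt ψ hψ]
    have h1 : q.evalAt y * ⟨up (q.evalAt a)⁻¹, hinv q hq⟩ = 1 := Subtype.ext (by
      change ((q.evalAt y : T.toSubalgebra) : ULift.{v} L) * up (q.evalAt a)⁻¹ = 1
      rw [hval, ← map_mul, mul_inv_cancel₀ (hQ q hq), map_one])
    intro h0
    have h2 := congrArg ψ h1
    rw [map_mul, h0, zero_mul, map_one] at h2
    exact zero_ne_one h2

theorem DeltaFiniteType.quotient {A S : Type*} [CommRing A] [CommRing S] [Algebra A S]
    [DeltaRing N S] (h : DeltaFiniteType N A S) {Q : Ideal S}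
    (hQ : Q.IsStable (DeltaRing.der (N := N))) :
    letI := hQ.deltaRing
    DeltaFiniteType N A (S ⧸ Q) := by
  classical
  let _ := hQ.deltaRing
  obtain ⟨F, hF⟩ := h
  refine ⟨F.image (Ideal.Quotient.mk Q), fun T hT => eq_top_iff.2 fun x _ => ?_⟩
  obtain ⟨x, rfl⟩ := Ideal.Quotient.mk_surjective x
  let T' : DeltaSubalgebra N A S :=
    { toSubalgebra := T.toSubalgebra.comap (Ideal.Quotient.mkₐ A Q)
      der_mem := fun i x hx => by
        have := T.der_mem i _ hx
        change Ideal.Quotient.mk Q (DeltaRing.der i x) ∈ T.toSubalgebra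
        rw [← SelfDerivation.quotient_mk (DeltaRing.der i) Q (hQ i) x]
        exact this }
  have := hF T' fun y hy => hT _ (Finset.mem_image_of_mem _ hy)
  have hx : x ∈ T'.toSubalgebra := this ▸ Algebra.mem_top
  exact hx

/-- If every domain of finite type over `K` has a `K`-point, then so does every nontrivial
differential algebra of finite type over `K`. -/
theorem exists_point_of_nontrivial {K : Type u} [Field K] [CharZero K] [DeltaRing N K]
    (h : ∀ (S : Type v) [CommRing S] [IsDomain S] [DeltaRing N S] [Algebra K S]
        [IsDeltaAlgebra N K S], DeltaFiniteType N K S →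
        ∃ ψ : S →ₐ[K] K, IsDeltaHom N (ψ : S →+* K))
    (S : Type v) [CommRing S] [Nontrivial S] [DeltaRing N S] [Algebra K S]
    [hS : IsDeltaAlgebra N K S] (hfin : DeltaFiniteType N K S) :
    ∃ ψ : S →ₐ[K] K, IsDeltaHom N (ψ : S →+* K) := by
  let _ : Algebra ℚ S := ((algebraMap K S).comp (algebraMap ℚ K)).toAlgebra
  have hbot : (⊥ : Ideal S).IsStable (DeltaRing.der (N := N)) := by
    intro i x hx
    rw [Ideal.mem_bot.1 hx, map_zero]
    exact Ideal.zero_mem _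
  -- With `b = 1` the condition on powers says only that the zero ideal is proper.
  obtain ⟨Q, hQ, hst, -, -⟩ := hbot.exists_le_prime (b := 1) (by simp)
  let _ := hst.deltaRing
  have hmk : ∀ (i : Fin N) (x : S),
      Ideal.Quotient.mk Q (DeltaRing.der i x) = DeltaRing.der i (Ideal.Quotient.mk Q x) :=
    fun i x => (SelfDerivation.quotient_mk (DeltaRing.der i) Q (hst i) x).symm
  have hKQ : IsDeltaAlgebra N K (S ⧸ Q) := ⟨fun i x =>
    (congrArg (Ideal.Quotient.mk Q) (hS.isDeltaHom_algebraMap i x)).trans (hmk i _)⟩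
  obtain ⟨ψ, hψ⟩ := h (S ⧸ Q) (hfin.quotient hst)
  exact ⟨ψ.comp (Ideal.Quotient.mkₐ K Q), fun i x => (congrArg ψ (hmk i x)).trans (hψ i _)⟩

/-- The image of `K` in a differential `K`-algebra. -/
def DeltaSubalgebra.image (N : ℕ) (K S : Type*) [Field K] [CharZero K] [CommRing S]
    [DeltaRing N K] [DeltaRing N S] [Algebra K S] [hS : IsDeltaAlgebra N K S] [Algebra ℚ S] :
    DeltaSubalgebra N ℚ S where
  toSubalgebra := (RingHom.toRatAlgHom (algebraMap K S)).range
  der_mem i x hx := by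
    obtain ⟨y, rfl⟩ := hx
    exact ⟨DeltaRing.der i y, hS.isDeltaHom_algebraMap i y⟩

theorem DeltaFiniteType.image {K S : Type*} [Field K] [CharZero K] [CommRing S]
    [DeltaRing N K] [DeltaRing N S] [Algebra K S] [IsDeltaAlgebra N K S] [Algebra ℚ S]
    (h : DeltaFiniteType N K S) :
    DeltaFiniteType N (DeltaSubalgebra.image N K S).toSubalgebra S := by
  obtain ⟨F, hF⟩ := h
  refine ⟨F, fun T hT => eq_top_iff.2 fun x _ => ?_⟩
  let T' : DeltaSubalgebra N K S :=
    { carrier := T.toSubalgebra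
      mul_mem' := T.toSubalgebra.mul_mem
      add_mem' := T.toSubalgebra.add_mem
      algebraMap_mem' := fun k => T.toSubalgebra.algebraMap_mem
        (⟨algebraMap K S k, ⟨k, rfl⟩⟩ : (DeltaSubalgebra.image N K S).toSubalgebra)
      der_mem := T.der_mem }
  have hx : x ∈ T'.toSubalgebra := hF T' hT ▸ Algebra.mem_top
  exact hx

/-- The extension property over differential subrings implies the existence of `K`-points. -/
theorem exists_point_of_exists_extension {K : Type u} [Field K] [CharZero K] [DeltaRing N K]
    (h : ∀ (S : Type v) [CommRing S] [IsDomain S] [Algebra ℚ S] [DeltaRing N S]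
        (R : DeltaSubalgebra N ℚ S), DeltaFiniteType N R.toSubalgebra S →
        ∀ b : S, b ≠ 0 → ∃ a : R.toSubalgebra, a ≠ 0 ∧
          ∀ φ : R.toSubalgebra →+* K, IsDeltaHom N φ → φ a ≠ 0 →
            ∃ ψ : S →+* K, IsDeltaHom N ψ ∧ (∀ r : R.toSubalgebra, ψ (r : S) = φ r) ∧ ψ b ≠ 0)
    (S : Type v) [CommRing S] [IsDomain S] [DeltaRing N S] [Algebra K S]
    [hS : IsDeltaAlgebra N K S] (hfin : DeltaFiniteType N K S) (b : S) (hb : b ≠ 0) :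
    ∃ ψ : S →ₐ[K] K, IsDeltaHom N (ψ : S →+* K) ∧ ψ b ≠ 0 := by
  let _ : Algebra ℚ S := ((algebraMap K S).comp (algebraMap ℚ K)).toAlgebra
  obtain ⟨a, ha0, ha⟩ := h S (DeltaSubalgebra.image N K S) hfin.image b hb
  let e : K ≃+* (DeltaSubalgebra.image N K S).toSubalgebra :=
    RingEquiv.ofBijective (RingHom.toRatAlgHom (algebraMap K S)).rangeRestrict
      ⟨RingHom.injective (RingHom.toRatAlgHom (algebraMap K S)).rangeRestrict.toRingHom,
        AlgHom.rangeRestrict_surjective _⟩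
  have he : ∀ i k, e (DeltaRing.der (N := N) i k) = DeltaRing.der i (e k) := fun i k =>
    Subtype.ext (hS.isDeltaHom_algebraMap i k)
  -- Extending the inverse of `K → R` is the same as being `K`-linear; being injective, this inverse
  -- does not kill the nonzero `a`.
  obtain ⟨ψ, hψ, hψe, hψb⟩ := ha e.symm (fun i x => by
    obtain ⟨k, rfl⟩ := e.surjective x
    change e.symm _ = DeltaRing.der i (e.symm _)
    rw [← he, e.symm_apply_apply, e.symm_apply_apply])
    (fun h0 => ha0 ((map_eq_zero_iff _ e.symm.injective).1 h0))
  exact ⟨{ ψ with commutes' := fun k => (hψe (e k)).trans (e.symm_apply_apply k) }, hψ, hψb⟩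

end Equivalences

theorem theorem4p2 (N : ℕ) (K : Type u) [Field K] [CharZero K] [DeltaRing N K] :
    List.TFAE [
      IsDifferentiallyClosed N K,
      ∀ (S : Type (max u v)) [CommRing S] [IsDomain S] [Algebra ℚ S] [DeltaRing N S]
        (R : DeltaSubalgebra N ℚ S), DeltaFiniteType N R.toSubalgebra S →
        ∀ b : S, b ≠ 0 → ∃ a : R.toSubalgebra, a ≠ 0 ∧
          ∀ φ : R.toSubalgebra →+* K, IsDeltaHom N φ → φ a ≠ 0 →
            ∃ ψ : S →+* K, IsDeltaHom N ψ ∧ (∀ r : R.toSubalgebra, ψ (r : S) = φ r) ∧ ψ b ≠ 0,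
      ∀ (S : Type (max u v)) [CommRing S] [IsDomain S] [DeltaRing N S] [Algebra K S]
        [IsDeltaAlgebra N K S], DeltaFiniteType N K S →
        ∀ b : S, b ≠ 0 → ∃ ψ : S →ₐ[K] K, IsDeltaHom N (ψ : S →+* K) ∧ ψ b ≠ 0,
      ∀ (S : Type (max u v)) [CommRing S] [IsDomain S] [DeltaRing N S] [Algebra K S]
        [IsDeltaAlgebra N K S], DeltaFiniteType N K S →
        ∃ ψ : S →ₐ[K] K, IsDeltaHom N (ψ : S →+* K),
      ∀ (S : Type (max u v)) [CommRing S] [Nontrivial S] [DeltaRing N S] [Algebra K S]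
        [IsDeltaAlgebra N K S], DeltaFiniteType N K S →
        ∃ ψ : S →ₐ[K] K, IsDeltaHom N (ψ : S →+* K)] := by
  tfae_have 1 → 2 := by
    intro hK S _ _ _ _ R hfin b hb
    exact hK.exists_extension (fun _ _ => rfl) hfin hb
  tfae_have 2 → 3 := by
    intro h S _ _ _ _ _ hfin b hb
    exact exists_point_of_exists_extension h S hfin b hb
  tfae_have 3 → 4 := by
    intro h S _ _ _ _ _ hfin
    obtain ⟨ψ, hψ, -⟩ := h S hfin 1 one_ne_zero
    exact ⟨ψ, hψ⟩
  tfae_have 4 → 5 := by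
    intro h S _ _ _ _ _ hfin
    exact exists_point_of_nontrivial h S hfin
  tfae_have 5 → 1 := by
    intro h
    refine IsDifferentiallyClosed.of_exists_point.{u, v} ?_
    intro S _ _ _ _ _ hfin
    exact h S hfin
  tfae_finish
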